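/- Let $M$ be a smooth surface (two-dimensional manifold without boundary) with a transversely oriented foliation $\mathcal F$ by curves, of class $C^r$ with $r\ge 3$. For a Riemannian metric $g$ on $M$ let $\nabla$ be its Levi-Civita connection and $N$ the positively oriented $g$-unit normal to $\mathcal F$; write $\hat X=X-g(X,N)N$ for the $\mathcal F$-component of a vector and $\hat g(X,Y)=g(\hat X,\hat Y)$, and let $\lambda$ be the geodesic curvature of the leaves with respect to $N$, i.e. $-\nabla_XN=\lambda X$ for $X$ tangent to $\mathcal F$. Let $\psi\in C^2(\mathbb R^2)$ and let $(g_t)_{0\le t<\varepsilon}$ be a family of Riemannian metrics on $M$, of class $C^2$ on $[0,\varepsilon)\times M$, which is an extrinsic geometric flow of type (b), that is, $$\partial_t g_t=\psi(\lambda_t,t)\,\hat g_t\qquad(0\le t<\varepsilon),$$ where $\lambda_t$ and $\hat g_t$ are the geodesic curvature of the leaves and the truncated metric of $g_t$. Let $N$ be the positively oriented $g_0$-unit normal to $\mathcal F$ (which is also the one for every $g_t$) and $\nabla^0$ the Levi-Civita connection of $g_0$. Then for all $t\in[0,\varepsilon)$ the Gaussian curvature $K_t$ of $g_t$ is, at every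 point of $M$, $$K_t=\operatorname{div}_{g_t}\!\Big(e^{-\int_0^t\psi(\lambda_s,s)\,ds}\,\nabla^0_NN\Big)+N(\lambda_t)-\lambda_t^2 .$$ -/

import Mathlib

open Set Filter Topology Bundle Manifold
open scoped Manifold ContDiff Topology

noncomputable section

namespace FoliatedSurface

/-- The model plane `ℝ²` with its Euclidean norm. -/
abbrev Plane : Type := EuclideanSpace ℝ (Fin 2)

/-! ### Riemannian geometry of a surface -/

section Riemannian

variable {M : Type*} [TopologicalSpace M] [ChartedSpace Plane M] [IsManifold (𝓡 2) ∞ M]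

variable (M) in
/-- Riemannian metrics of class `C²` on the surface `M`. -/
abbrev Metric : Type _ :=
  Bundle.ContMDiffRiemannianMetric (𝓡 2) 2 Plane (fun p : M ↦ TangentSpace (𝓡 2) p)

variable (M) in
/-- (Not necessarily continuous) vector fields on `M`. -/
abbrev VField : Type _ := (p : M) → TangentSpace (𝓡 2) p

/-- The `i`-th coordinate vector field of the preferred chart of `M` at `p`
(defined near `p`, junk outside of the domain of the chart). -/
def coordField (p : M) (i : Fin 2) : VField M := fun q ↦
  (trivializationAt Plane (TangentSpace (𝓡 2)) p).symm q (EuclideanSpace.single i (1 : ℝ))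

/-- The `i`-th component of the vector field `Y` in the preferred chart of `M` at `p`. -/
def coordComp (p : M) (Y : VField M) (i : Fin 2) : M → ℝ := fun q ↦
  (trivializationAt Plane (TangentSpace (𝓡 2)) p ⟨q, Y q⟩).2 i

/-- The `i`-th coordinate of a vector at `p`, in the preferred chart of `M` at `p`. -/
def coordL (p : M) (i : Fin 2) : TangentSpace (𝓡 2) p →L[ℝ] ℝ :=
  (EuclideanSpace.proj i : Plane →L[ℝ] ℝ).comp
    ((trivializationAt Plane (TangentSpace (𝓡 2)) p).continuousLinearMapAt ℝ p)

/-- The coefficients `g_{ij}` of the metric in the preferred chart of `M` at `p`. -/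
def gram (g : Metric M) (p q : M) (i j : Fin 2) : ℝ :=
  g.inner q (coordField p i q) (coordField p j q)

/-- The derivative `∂_k g_{ij}` at `p`, in the preferred chart of `M` at `p`. -/
def dGram (g : Metric M) (p : M) (k i j : Fin 2) : ℝ :=
  mvfderiv (𝓡 2) (fun q ↦ gram g p q i j) p (coordField p k p)

/-- The Christoffel symbol
`Γ^k_{ij} = ½ ∑ₗ g^{kl} (∂_i g_{jl} + ∂_j g_{il} - ∂_l g_{ij})` at `p`,
in the preferred chart of `M` at `p`. -/
def christoffel (g : Metric M) (p : M) (k i j : Fin 2) : ℝ :=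
  (1 / 2) * ∑ l, (Matrix.of (gram g p p))⁻¹ k l * (dGram g p i j l + dGram g p j i l - dGram g p l i j)

/-- The Levi-Civita connection of `g`: `nabla g Y p v` is `∇_v Y`, whose `k`-th component is
`v(Y^k) + ∑ᵢⱼ Γ^k_{ij} v^i Y^j` (in the preferred chart at `p`). -/
def nabla (g : Metric M) (Y : VField M) (p : M) :
    TangentSpace (𝓡 2) p →L[ℝ] TangentSpace (𝓡 2) p :=
  ∑ k, ContinuousLinearMap.smulRight
    (mvfderiv (𝓡 2) (coordComp p Y k) p +
      ∑ i, ∑ j, (christoffel g p k i j * coordComp p Y j p) • coordL p i)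
    (coordField p k p)

/-- The divergence of a vector field: `div V = tr (v ↦ ∇_v V)`. -/
def divergence (g : Metric M) (V : VField M) (p : M) : ℝ :=
  LinearMap.trace ℝ (TangentSpace (𝓡 2) p) (nabla g V p).toLinearMap

/-- The curvature `R(X,Y)Z = ∇_X ∇_Y Z - ∇_Y ∇_X Z - ∇_{[X,Y]} Z`. -/
def curvature (g : Metric M) (X Y Z : VField M) (p : M) : TangentSpace (𝓡 2) p :=
  nabla g (fun q ↦ nabla g Z q (Y q)) p (X p)
    - nabla g (fun q ↦ nabla g Z q (X q)) p (Y p)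
    - nabla g Z p (VectorField.mlieBracket (𝓡 2) X Y p)

/-- The Gaussian curvature
`K = g(R(X,Y)Y,X) / (g(X,X) g(Y,Y) - g(X,Y)²)` at `p`, computed with the coordinate fields `X`, `Y`
of the preferred chart of `M` at `p`. -/
def gaussCurvature (g : Metric M) (p : M) : ℝ :=
  g.inner p (curvature g (coordField p 0) (coordField p 1) (coordField p 1) p) (coordField p 0 p) /
    (Matrix.of (gram g p p)).det

end Riemannian

/-! ### Foliations by curves -/

section Foliation

variable {M : Type*} [TopologicalSpace M] [ChartedSpace Plane M]

/-- The chart `φ` of `M` is foliated for the family `leaves`: for every leaf `L` meeting the domain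
`U` of `φ`, the connected components of `φ (U ∩ L)` are the slices `x₂ = c`. -/
def IsFoliatedChart (leaves : Set (Set M)) (φ : OpenPartialHomeomorph M Plane) : Prop :=
  ∀ L ∈ leaves, ∀ q ∈ φ.source ∩ L,
    connectedComponentIn (φ '' (φ.source ∩ L)) (φ q) = {y ∈ φ.target | y 1 = φ q 1}

variable (M) in
/-- A one-dimensional foliation of class `C^r` of the surface `M`. -/
structure Foliation (r : WithTop ℕ∞) where
  /-- The leaves. -/
  leaves : Set (Set M)
  isConnected : ∀ L ∈ leaves, IsConnected L
  iUnion_leaves : ⋃₀ leaves = univ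
  disjoint : leaves.PairwiseDisjoint id
  exists_chart : ∀ p : M, ∃ φ ∈ IsManifold.maximalAtlas (𝓡 2) r M,
    p ∈ φ.source ∧ φ p = 0 ∧ IsFoliatedChart leaves φ

/-- The tangent bundle `Tℱ ⊆ TM` of the foliation: the velocities of the `C¹` curves lying in a
leaf. -/
def Foliation.tangent {r : WithTop ℕ∞} (ℱ : Foliation M r) : Set (TangentBundle (𝓡 2) M) :=
  {w | ∃ L ∈ ℱ.leaves, ∃ γ : ℝ → M, ContMDiffAt 𝓘(ℝ, ℝ) (𝓡 2) 1 γ 0 ∧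
    (∀ᶠ s in 𝓝 (0 : ℝ), γ s ∈ L) ∧ w = ⟨γ 0, mfderiv 𝓘(ℝ, ℝ) (𝓡 2) γ 0 (1 : ℝ)⟩}

/-- A transverse orientation of a foliation by curves of a surface, given by a continuous vector
field transverse to the leaves, which points to the positive side of the leaves. -/
structure TransverseOrientation {r : WithTop ℕ∞} [IsManifold (𝓡 2) ∞ M] (ℱ : Foliation M r) where
  /-- The transverse vector field. -/
  field : VField M
  continuous_field : Continuous fun p ↦ (⟨p, field p⟩ : TangentBundle (𝓡 2) M)
  transverse : ∀ p, (⟨p, field p⟩ : TangentBundle (𝓡 2) M) ∉ ℱ.tangent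

end Foliation

/-! ### Extrinsic geometry of the leaves and the flow -/

section EGF

variable {M : Type*} [TopologicalSpace M] [ChartedSpace Plane M] [IsManifold (𝓡 2) ∞ M]
  {r : WithTop ℕ∞} {ℱ : Foliation M r}

/-- `N` is the positively oriented unit normal of the foliation for the metric `g`. -/
structure IsUnitNormal (o : TransverseOrientation ℱ) (g : Metric M) (N : VField M) : Prop where
  unit : ∀ p, g.inner p (N p) (N p) = 1
  normal : ∀ w ∈ ℱ.tangent, g.inner w.1 (N w.1) w.2 = 0
  positive : ∀ p, 0 < g.inner p (N p) (o.field p)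

/-- The component `X̂ = X - g(X,N) N` of a vector along the foliation with unit normal `N`. -/
def hat (g : Metric M) (N : VField M) (p : M) :
    TangentSpace (𝓡 2) p →L[ℝ] TangentSpace (𝓡 2) p :=
  ContinuousLinearMap.id ℝ (TangentSpace (𝓡 2) p) - (g.inner p (N p)).smulRight (N p)

/-- The Weingarten operator `A X = -∇_X N` for `X` tangent to the leaves, extended by `A N = 0`. -/
def weingarten (g : Metric M) (N : VField M) (p : M) :
    TangentSpace (𝓡 2) p →L[ℝ] TangentSpace (𝓡 2) p :=
  -((nabla g N p).comp (hat g N p))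

/-- The geodesic curvature `λ` of the leaves with respect to `N`, that is, the only principal
curvature of the leaves: `λ = τ₁ = tr A`. -/
def geodCurvature (g : Metric M) (N : VField M) (p : M) : ℝ :=
  LinearMap.trace ℝ (TangentSpace (𝓡 2) p) (weingarten g N p).toLinearMap

/-- The family `g t`, `t ∈ [0, ε)`, of Riemannian metrics on the foliated surface, with the positive
unit normals `N t`, is an extrinsic geometric flow of type (b) with the function `ψ`: it is of class
`C²` on `[0, ε) × M` and `∂ₜ g_t = ψ(λ_t, t) ĝ_t`, where `ĝ_t(u, v) = g_t(û, v̂)`. -/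
structure IsEGF (o : TransverseOrientation ℱ) (ψ : ℝ × ℝ → ℝ) (ε : ℝ) (g : ℝ → Metric M)
    (N : ℝ → VField M) : Prop where
  contMDiffOn : ContMDiffOn (𝓘(ℝ, ℝ).prod (𝓡 2)) ((𝓡 2).prod 𝓘(ℝ, Plane →L[ℝ] Plane →L[ℝ] ℝ)) 2
    (fun q : ℝ × M ↦ (TotalSpace.mk' (Plane →L[ℝ] Plane →L[ℝ] ℝ) q.2 ((g q.1).inner q.2) :
      TotalSpace (Plane →L[ℝ] Plane →L[ℝ] ℝ)
        (fun p : M ↦ TangentSpace (𝓡 2) p →L[ℝ] TangentSpace (𝓡 2) p →L[ℝ] ℝ)))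
    (Ico 0 ε ×ˢ univ)
  isUnitNormal : ∀ t ∈ Ico 0 ε, IsUnitNormal o (g t) (N t)
  hasDerivWithinAt : ∀ t ∈ Ico 0 ε, ∀ (p : M) (u v : TangentSpace (𝓡 2) p),
    HasDerivWithinAt (fun s ↦ (g s).inner p u v)
      (ψ (geodCurvature (g t) (N t) p, t) *
        (g t).inner p (hat (g t) (N t) p u) (hat (g t) (N t) p v)) (Ico 0 ε) t

end EGF

end FoliatedSurface

end

noncomputable section

namespace FoliatedSurface

set_option linter.unusedSectionVars false

variable {M : Type*} [TopologicalSpace M] [ChartedSpace Plane M] [IsManifold (𝓡 2) ∞ M]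

/-! Two facts combine. For a single metric, take an orthonormal frame `T`, `N` with `T` tangent to
the leaves, and let ω(v) = g(∇_v T, N). Then ω(T) = λ and ω(N) = -κ with κ = g(T, ∇_N N), and the
structure equation dω(T, N) = -K reads K = T(κ) - κ² + N(λ) - λ² (`IsFrameAt.gaussCurvature_eq`).
Since ∇_N N = κT, the first two terms are div(∇_N N) (`IsFrameAt.divergence_nabla_N`). So K =
div(∇_N N) + N(λ) - λ² for every metric.

For the flow, the truncated metric does not see `N`: the unit normal and the one-form g_t(N, ·) stay
constant (`IsEGF.normal_eq`, `IsEGF.inner_normal_eq`), while g_t(U, ·) is multiplied by e^{∫ψ} for U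
tangent to ℱ (`IsEGF.inner_tangent_eq`). Moreover g(U, ∇_N N) = -g(N, [N, U]) involves the metric
only through g(N, ·) (`IsUnitNormal.inner_nabla_tangent`), so it is constant in time, and ∇^t_N N =
e^{-∫ψ} ∇^0_N N (`IsEGF.nabla_normal_eq`).

`nabla` at a point q uses the preferred chart at q, which may jump with q. Derivatives of `nabla`
are therefore accessible only through chart-free descriptions: metric compatibility and absence of
torsion turn frame coefficients into inner products and Lie brackets, whose regularity is known. -/

/-- The vector field `Y` is of class `C^n` at `p`. -/
abbrev VField.ContAt (n : WithTop ℕ∞) (Y : VField M) (p : M) : Prop :=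
  ContMDiffAt (𝓡 2) (𝓡 2).tangent n (fun q ↦ (⟨q, Y q⟩ : TangentBundle (𝓡 2) M)) p

/-- The vector field `Y` is differentiable at `p`. -/
abbrev VField.DiffAt (Y : VField M) (p : M) : Prop :=
  MDifferentiableAt (𝓡 2) (𝓡 2).tangent (fun q ↦ (⟨q, Y q⟩ : TangentBundle (𝓡 2) M)) p

instance (p : M) : Module.Finite ℝ (TangentSpace (𝓡 2) p) :=
  inferInstanceAs (Module.Finite ℝ Plane)

lemma finrank_tangentSpace (p : M) : Module.finrank ℝ (TangentSpace (𝓡 2) p) = 2 :=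
  (finrank_euclideanSpace_fin : Module.finrank ℝ Plane = 2)

/-! ### Regularity of vector fields, inner products and brackets -/

lemma VField.ContAt.eventually {n : ℕ} {Y : VField M} {p : M} (h : VField.ContAt n Y p) :
    ∀ᶠ q in 𝓝 p, VField.ContAt n Y q := by
  have : IsManifold (𝓡 2) ((n : WithTop ℕ∞) + 1) M :=
    inferInstanceAs (IsManifold (𝓡 2) ((n + 1 : ℕ) : WithTop ℕ∞) M)
  have : IsManifold (𝓡 2).tangent n (TangentBundle (𝓡 2) M) := inferInstance
  exact (contMDiffAt_iff_contMDiffAt_nhds (by simp)).1 h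

lemma contMDiffAt_inner {n : WithTop ℕ∞} (hn : n ≤ 2) (g : Metric M) {X Y : VField M} {p : M}
    (hX : VField.ContAt n X p) (hY : VField.ContAt n Y p) :
    ContMDiffAt (𝓡 2) 𝓘(ℝ, ℝ) n (fun q ↦ g.inner q (X q) (Y q)) p := by
  have := ContMDiffAt.clm_bundle_apply₂ (F₁ := Plane) (F₂ := Plane) (F₃ := ℝ) (E₃ := fun _ ↦ ℝ)
    (b := fun q : M ↦ q) ((g.contMDiff p).of_le hn) hX hY
  rw [Bundle.contMDiffAt_section] at this
  exact this

lemma mdifferentiableAt_inner (g : Metric M) {X Y : VField M} {p : M}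
    (hX : VField.DiffAt X p) (hY : VField.DiffAt Y p) :
    MDifferentiableAt (𝓡 2) 𝓘(ℝ, ℝ) (fun q ↦ g.inner q (X q) (Y q)) p := by
  have := MDifferentiableAt.clm_bundle_apply₂ (F₁ := Plane) (F₂ := Plane) (F₃ := ℝ)
    (E₃ := fun _ ↦ ℝ) (b := fun q : M ↦ q) ((g.contMDiff p).mdifferentiableAt (by simp)) hX hY
  rw [mdifferentiableAt_section] at this
  exact this

lemma isManifold_minSmoothness_two : IsManifold (𝓡 2) (minSmoothness ℝ 2) M := by
  rw [minSmoothness_of_isRCLikeNormedField]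
  infer_instance

lemma VField.ContAt.mlieBracket {X Y : VField M} {p : M} (hX : VField.ContAt 2 X p)
    (hY : VField.ContAt 2 Y p) : VField.ContAt 1 (VectorField.mlieBracket (𝓡 2) X Y) p := by
  have h3 : IsManifold (𝓡 2) ((2 : ℕ∞) + 1) M := inferInstanceAs (IsManifold (𝓡 2) 3 M)
  have := isManifold_minSmoothness_two (M := M)
  exact ContMDiffAt.mlieBracket_vectorField (n := 2) (m := 1) hX hY (by simp; norm_num)

lemma mvfderiv_congr {f h : M → ℝ} {p : M} (H : f =ᶠ[𝓝 p] h) :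
    mvfderiv (𝓡 2) f p = mvfderiv (𝓡 2) h p := by
  have h1 : mfderiv (𝓡 2) 𝓘(ℝ, ℝ) f p = mfderiv (𝓡 2) 𝓘(ℝ, ℝ) h p := H.mfderiv_eq
  ext v
  exact congrArg (fun L ↦ L v) h1

/-! ### Coordinate fields -/

lemma mem_baseSet_trivializationAt {p q : M} (hq : q ∈ (chartAt Plane p).source) :
    q ∈ (trivializationAt Plane (TangentSpace (𝓡 2)) p).baseSet := by
  simpa using hq

lemma eventually_mem_chart_source (p : M) : ∀ᶠ q in 𝓝 p, q ∈ (chartAt Plane p).source :=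
  (chartAt Plane p).open_source.mem_nhds (mem_chart_source Plane p)

lemma trivializationAt_coordField {p q : M} (hq : q ∈ (chartAt Plane p).source) (i : Fin 2) :
    trivializationAt Plane (TangentSpace (𝓡 2)) p ⟨q, coordField p i q⟩ =
      (q, EuclideanSpace.single i (1 : ℝ)) :=
  Trivialization.apply_mk_symm _ (mem_baseSet_trivializationAt hq) _

lemma contAt_coordField {p q : M} (hq : q ∈ (chartAt Plane p).source) (i : Fin 2)
    (n : ℕ∞) : VField.ContAt n (coordField p i) q := by
  have h : ContMDiffOn (𝓡 2) (𝓡 2).tangent ∞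
      (fun q ↦ (⟨q, coordField p i q⟩ : TangentBundle (𝓡 2) M))
      (trivializationAt Plane (TangentSpace (𝓡 2)) p).baseSet := by
    rw [(trivializationAt Plane (TangentSpace (𝓡 2)) p).contMDiffOn_section_baseSet_iff]
    refine (contMDiffOn_const (c := EuclideanSpace.single i (1 : ℝ))).congr fun q hq ↦ ?_
    rw [trivializationAt_coordField (by simpa using hq)]
  refine (h.contMDiffAt ?_).of_le (by exact_mod_cast le_top)
  exact (Trivialization.open_baseSet _).mem_nhds (mem_baseSet_trivializationAt hq)

lemma mdifferentiableAt_coordComp {p : M} {Y : VField M} (hY : VField.DiffAt Y p) (i : Fin 2) :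
    MDifferentiableAt (𝓡 2) 𝓘(ℝ, ℝ) (coordComp p Y i) p := by
  have h := (mdifferentiableAt_section (F := Plane) (𝓡 2)
    (E := fun q : M ↦ TangentSpace (𝓡 2) q) Y).1 hY
  exact ((EuclideanSpace.proj i : Plane →L[ℝ] ℝ).mdifferentiableAt).comp p h

lemma sum_smul_coordField {p q : M} (hq : q ∈ (chartAt Plane p).source)
    (v : TangentSpace (𝓡 2) q) :
    ∑ i, (trivializationAt Plane (TangentSpace (𝓡 2)) p ⟨q, v⟩).2 i • coordField p i q = v := by
  have hb := mem_baseSet_trivializationAt hq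
  set e := trivializationAt Plane (TangentSpace (𝓡 2)) p
  have h1 : ∀ i, coordField p i q = e.symmL ℝ q (EuclideanSpace.single i (1 : ℝ)) := fun i ↦
    (e.symmL_apply (R := ℝ) hb _).symm
  have h2 : e.symmL ℝ q (e ⟨q, v⟩).2 = v := by
    rw [e.symmL_apply hb]
    exact Trivialization.symm_apply_apply_mk e hb v
  simp_rw [h1, ← map_smul, ← map_sum]
  conv_rhs => rw [← h2]
  congr 1
  ext j
  fin_cases j <;> simp [e]

lemma sum_coordComp {p q : M} (hq : q ∈ (chartAt Plane p).source) (Y : VField M) :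
    ∑ i, coordComp p Y i q • coordField p i q = Y q :=
  sum_smul_coordField hq (Y q)

lemma coordL_apply (p : M) (i : Fin 2) (v : TangentSpace (𝓡 2) p) :
    coordL p i v = (trivializationAt Plane (TangentSpace (𝓡 2)) p ⟨p, v⟩).2 i := by
  have h : (trivializationAt Plane (TangentSpace (𝓡 2)) p).continuousLinearMapAt ℝ p v =
      (trivializationAt Plane (TangentSpace (𝓡 2)) p ⟨p, v⟩).2 := by
    rw [Trivialization.continuousLinearMapAt_apply, Trivialization.linearMapAt_apply,
      if_pos (mem_baseSet_trivializationAt (mem_chart_source Plane p))]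
  rw [← h]
  rfl

lemma coordComp_self (p : M) (Y : VField M) (i : Fin 2) :
    coordComp p Y i p = coordL p i (Y p) :=
  (coordL_apply p i (Y p)).symm

lemma sum_coordL (p : M) (v : TangentSpace (𝓡 2) p) :
    ∑ i, coordL p i v • coordField p i p = v := by
  simp_rw [coordL_apply]
  exact sum_smul_coordField (mem_chart_source Plane p) v

lemma coordL_coordField (p : M) (i j : Fin 2) :
    coordL p i (coordField p j p) = if i = j then 1 else 0 := by
  rw [coordL_apply, trivializationAt_coordField (mem_chart_source Plane p)]
  simp

lemma mfderiv_extChartAt_coordField {p q : M} (hq : q ∈ (chartAt Plane p).source) (i : Fin 2) :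
    mfderiv (𝓡 2) 𝓘(ℝ, Plane) (extChartAt (𝓡 2) p) q (coordField p i q) =
      (EuclideanSpace.single i (1 : ℝ) : Plane) := by
  have h : (trivializationAt Plane (TangentSpace (𝓡 2)) p).continuousLinearMapAt ℝ q
      (coordField p i q) = EuclideanSpace.single i (1 : ℝ) := by
    rw [Trivialization.continuousLinearMapAt_apply, Trivialization.linearMapAt_apply,
      if_pos (mem_baseSet_trivializationAt hq), trivializationAt_coordField hq]
  rw [TangentBundle.continuousLinearMapAt_trivializationAt hq] at h
  exact h

/-- The constant vector field on the plane. -/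
def constField (v : Plane) : (y : Plane) → TangentSpace 𝓘(ℝ, Plane) y := fun _ ↦ v

lemma contMDiffAt_constField (v : Plane) (y : Plane) (n : WithTop ℕ∞) :
    ContMDiffAt 𝓘(ℝ, Plane) 𝓘(ℝ, Plane).tangent n
      (fun q : Plane ↦ (⟨q, constField v q⟩ : TangentBundle 𝓘(ℝ, Plane) Plane)) y :=
  contMDiffAt_vectorSpace_iff_contDiffAt.2 contDiffAt_const

lemma coordField_eq_mpullback {p q : M} (hq : q ∈ (chartAt Plane p).source) (i : Fin 2) :
    coordField p i q = VectorField.mpullback (𝓡 2) 𝓘(ℝ, Plane) (extChartAt (𝓡 2) p)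
      (constField (EuclideanSpace.single i (1 : ℝ))) q := by
  have h := isInvertible_mfderiv_extChartAt (I := 𝓡 2) (x := p) (y := q) (by simpa using hq)
  rw [VectorField.mpullback_apply]
  have := mfderiv_extChartAt_coordField hq i
  exact (h.inverse_apply_eq.2 this.symm).symm

/-- Coordinate fields are pullbacks of constant fields under the chart, and the bracket is natural
under pullback. -/
lemma mlieBracket_coordField (p : M) (i j : Fin 2) :
    VectorField.mlieBracket (𝓡 2) (coordField p i) (coordField p j) p = 0 := by
  have hi : ∀ i, coordField p i =ᶠ[𝓝 p] VectorField.mpullback (𝓡 2) 𝓘(ℝ, Plane)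
      (extChartAt (𝓡 2) p) (constField (EuclideanSpace.single i (1 : ℝ))) := fun i ↦
    (eventually_mem_chart_source p).mono fun q hq ↦ coordField_eq_mpullback hq i
  rw [(hi i).mlieBracket_vectorField_eq (hi j)]
  have hc : ∀ i, MDifferentiableAt 𝓘(ℝ, Plane) 𝓘(ℝ, Plane).tangent
      (fun q : Plane ↦ (⟨q, constField (EuclideanSpace.single i (1 : ℝ)) q⟩ :
        TangentBundle 𝓘(ℝ, Plane) Plane)) (extChartAt (𝓡 2) p p) := fun i ↦
    (contMDiffAt_constField _ _ 1).mdifferentiableAt (by simp)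
  have := isManifold_minSmoothness_two (M := M)
  have : IsManifold 𝓘(ℝ, Plane) (minSmoothness ℝ 2) Plane := inferInstance
  rw [← VectorField.mpullback_mlieBracket (n := 2) (hc i) (hc j) contMDiffAt_extChartAt (by simp)]
  have h0 : VectorField.mlieBracket 𝓘(ℝ, Plane) (constField (EuclideanSpace.single i (1 : ℝ)))
      (constField (EuclideanSpace.single j (1 : ℝ))) (extChartAt (𝓡 2) p p) = 0 := by
    have h1 : VectorField.lieBracketWithin ℝ
        (fun _ : Plane ↦ (EuclideanSpace.single i (1 : ℝ) : Plane))
        (fun _ ↦ EuclideanSpace.single j (1 : ℝ)) univ (extChartAt (𝓡 2) p p) = 0 := by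
      simp [VectorField.lieBracketWithin]
    rw [← VectorField.mlieBracketWithin_univ]
    exact (congrFun VectorField.mlieBracketWithin_eq_lieBracketWithin _).trans h1
  rw [VectorField.mpullback_apply, h0, map_zero]

/-- Coordinate fields act on functions as the partial derivatives in the chart. -/
lemma mvfderiv_coordField_eq {p q : M} {f : M → ℝ} (hq : q ∈ (chartAt Plane p).source)
    (hf : MDifferentiableAt (𝓡 2) 𝓘(ℝ, ℝ) f q) (i : Fin 2) :
    mvfderiv (𝓡 2) f q (coordField p i q) =
      fderiv ℝ (f ∘ (extChartAt (𝓡 2) p).symm) (extChartAt (𝓡 2) p q)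
        (EuclideanSpace.single i (1 : ℝ)) := by
  have hs : q ∈ (extChartAt (𝓡 2) p).source := by simpa using hq
  have ht : (extChartAt (𝓡 2) p).target ∈ 𝓝 (extChartAt (𝓡 2) p q) :=
    (isOpen_extChartAt_target p).mem_nhds ((extChartAt (𝓡 2) p).map_source hs)
  have h1 : f =ᶠ[𝓝 q] (f ∘ (extChartAt (𝓡 2) p).symm) ∘ extChartAt (𝓡 2) p := by
    filter_upwards [(isOpen_extChartAt_source (I := 𝓡 2) p).mem_nhds hs] with x hx
    simp only [Function.comp_apply, (extChartAt (𝓡 2) p).left_inv hx]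
  have h2 : MDifferentiableAt 𝓘(ℝ, Plane) 𝓘(ℝ, ℝ) (f ∘ (extChartAt (𝓡 2) p).symm)
      (extChartAt (𝓡 2) p q) := by
    refine MDifferentiableAt.comp_of_eq _ hf ?_ ((extChartAt (𝓡 2) p).left_inv hs)
    exact ((contMDiffOn_extChartAt_symm (n := 1) p).contMDiffAt ht).mdifferentiableAt (by simp)
  rw [mvfderiv_congr h1, mvfderiv_comp_apply _ h2 (mdifferentiableAt_extChartAt hq)]
  rw [mfderiv_extChartAt_coordField hq]
  simp only [mvfderiv, mfderiv_eq_fderiv]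
  rfl

lemma contDiffAt_comp_extChartAt_symm {p : M} {f : M → ℝ} {n : ℕ∞}
    (hf : ContMDiffAt (𝓡 2) 𝓘(ℝ, ℝ) n f p) :
    ContDiffAt ℝ n (f ∘ (extChartAt (𝓡 2) p).symm) (extChartAt (𝓡 2) p p) := by
  have ht : (extChartAt (𝓡 2) p).target ∈ 𝓝 (extChartAt (𝓡 2) p p) :=
    extChartAt_target_mem_nhds p
  rw [← contMDiffAt_iff_contDiffAt]
  refine ContMDiffAt.comp_of_eq hf ?_ (extChartAt_to_inv p)
  exact (((contMDiffOn_extChartAt_symm (n := ∞) p).contMDiffAt ht)).of_le (by exact_mod_cast le_top)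

lemma mvfderiv_coordField_eventuallyEq {p : M} {f : M → ℝ}
    (hf : ContMDiffAt (𝓡 2) 𝓘(ℝ, ℝ) 2 f p) (i : Fin 2) :
    (fun q ↦ mvfderiv (𝓡 2) f q (coordField p i q)) =ᶠ[𝓝 p]
      (fun y ↦ fderiv ℝ (f ∘ (extChartAt (𝓡 2) p).symm) y (EuclideanSpace.single i (1 : ℝ))) ∘
        extChartAt (𝓡 2) p := by
  have h2 : ∀ᶠ q in 𝓝 p, ContMDiffAt (𝓡 2) 𝓘(ℝ, ℝ) 2 f q :=
    (contMDiffAt_iff_contMDiffAt_nhds (by simp)).1 hf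
  filter_upwards [eventually_mem_chart_source p, h2] with q hq hfq
  exact mvfderiv_coordField_eq hq (hfq.mdifferentiableAt (by simp)) i

lemma differentiableAt_fderiv_comp_extChartAt_symm {p : M} {f : M → ℝ}
    (hf : ContMDiffAt (𝓡 2) 𝓘(ℝ, ℝ) 2 f p) :
    DifferentiableAt ℝ (fderiv ℝ (f ∘ (extChartAt (𝓡 2) p).symm)) (extChartAt (𝓡 2) p p) :=
  ((contDiffAt_comp_extChartAt_symm (n := 2) hf).fderiv_right (m := 1)
    (by norm_num)).differentiableAt (by simp)

lemma mdifferentiableAt_mvfderiv_coordField {p : M} {f : M → ℝ}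
    (hf : ContMDiffAt (𝓡 2) 𝓘(ℝ, ℝ) 2 f p) (i : Fin 2) :
    MDifferentiableAt (𝓡 2) 𝓘(ℝ, ℝ) (fun q ↦ mvfderiv (𝓡 2) f q (coordField p i q)) p := by
  refine MDifferentiableAt.congr_of_eventuallyEq ?_ (mvfderiv_coordField_eventuallyEq hf i)
  refine MDifferentiableAt.comp p ?_ (mdifferentiableAt_extChartAt (mem_chart_source Plane p))
  exact ((differentiableAt_fderiv_comp_extChartAt_symm hf).clm_apply
    (differentiableAt_const _)).mdifferentiableAt

/-- The partial derivatives of a `C²` function commute. -/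
lemma mvfderiv_mvfderiv_coordField_comm {p : M} {f : M → ℝ}
    (hf : ContMDiffAt (𝓡 2) 𝓘(ℝ, ℝ) 2 f p) (i j : Fin 2) :
    mvfderiv (𝓡 2) (fun q ↦ mvfderiv (𝓡 2) f q (coordField p i q)) p (coordField p j p) =
      mvfderiv (𝓡 2) (fun q ↦ mvfderiv (𝓡 2) f q (coordField p j q)) p (coordField p i p) := by
  have hd := differentiableAt_fderiv_comp_extChartAt_symm hf
  have key : ∀ i j, mvfderiv (𝓡 2) (fun q ↦ mvfderiv (𝓡 2) f q (coordField p i q)) p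
      (coordField p j p) = fderiv ℝ (fderiv ℝ (f ∘ (extChartAt (𝓡 2) p).symm))
        (extChartAt (𝓡 2) p p) (EuclideanSpace.single j (1 : ℝ))
        (EuclideanSpace.single i (1 : ℝ)) := by
    intro i j
    rw [mvfderiv_congr (mvfderiv_coordField_eventuallyEq hf i), mvfderiv_comp_apply _
      (hd.clm_apply (differentiableAt_const _)).mdifferentiableAt
      (mdifferentiableAt_extChartAt (mem_chart_source Plane p)),
      mfderiv_extChartAt_coordField (mem_chart_source Plane p)]
    simp only [mvfderiv, mfderiv_eq_fderiv]
    change fderiv ℝ (fun y ↦ fderiv ℝ (f ∘ (extChartAt (𝓡 2) p).symm) y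
      (EuclideanSpace.single i (1 : ℝ))) (extChartAt (𝓡 2) p p)
        (EuclideanSpace.single j (1 : ℝ)) = _
    rw [fderiv_clm_apply hd (differentiableAt_const _)]
    simp
  rw [key, key]
  exact (contDiffAt_comp_extChartAt_symm (n := 2) hf).isSymmSndFDerivAt (by simp) _ _

/-! ### The Levi-Civita connection -/

lemma coordComp_add_eventuallyEq (p : M) (Y Z : VField M) (i : Fin 2) :
    coordComp p (Y + Z) i =ᶠ[𝓝 p] coordComp p Y i + coordComp p Z i := by
  filter_upwards [eventually_mem_chart_source p] with q hq
  have h := ((trivializationAt Plane (TangentSpace (𝓡 2)) p).linear ℝ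
    (mem_baseSet_trivializationAt hq)).map_add (Y q) (Z q)
  simp only [coordComp, Pi.add_apply]
  rw [h]
  rfl

lemma coordComp_smul_eventuallyEq (p : M) (f : M → ℝ) (Y : VField M) (i : Fin 2) :
    coordComp p (f • Y) i =ᶠ[𝓝 p] f * coordComp p Y i := by
  filter_upwards [eventually_mem_chart_source p] with q hq
  have h := ((trivializationAt Plane (TangentSpace (𝓡 2)) p).linear ℝ
    (mem_baseSet_trivializationAt hq)).map_smul (f q) (Y q)
  simp only [coordComp, Pi.mul_apply, Pi.smul_apply']
  rw [h]
  rfl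

lemma nabla_apply (g : Metric M) (Y : VField M) (p : M) (v : TangentSpace (𝓡 2) p) :
    nabla g Y p v = ∑ k, (mvfderiv (𝓡 2) (coordComp p Y k) p v +
      ∑ i, ∑ j, christoffel g p k i j * coordComp p Y j p * coordL p i v) • coordField p k p := by
  simp [nabla]

lemma nabla_congr (g : Metric M) {Y Z : VField M} {p : M} (h : Y =ᶠ[𝓝 p] Z) :
    nabla g Y p = nabla g Z p := by
  have h1 : ∀ k, coordComp p Y k =ᶠ[𝓝 p] coordComp p Z k := fun k ↦ h.mono fun q hq ↦ by
    simp only [coordComp, hq]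
  unfold nabla
  simp only [mvfderiv_congr (h1 _), (h1 _).self_of_nhds]

lemma nabla_add (g : Metric M) {Y Z : VField M} {p : M} (hY : VField.DiffAt Y p)
    (hZ : VField.DiffAt Z p) (v : TangentSpace (𝓡 2) p) :
    nabla g (Y + Z) p v = nabla g Y p v + nabla g Z p v := by
  simp only [nabla_apply, mvfderiv_congr (coordComp_add_eventuallyEq p Y Z _),
    (coordComp_add_eventuallyEq p Y Z _).self_of_nhds]
  rw [← Finset.sum_add_distrib]
  refine Finset.sum_congr rfl fun k _ ↦ ?_
  rw [mvfderiv_add (mdifferentiableAt_coordComp hY k) (mdifferentiableAt_coordComp hZ k),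
    ← add_smul]
  congr 1
  simp [Fin.sum_univ_two]
  ring

lemma nabla_smul (g : Metric M) {f : M → ℝ} {Y : VField M} {p : M}
    (hf : MDifferentiableAt (𝓡 2) 𝓘(ℝ, ℝ) f p) (hY : VField.DiffAt Y p)
    (v : TangentSpace (𝓡 2) p) :
    nabla g (f • Y) p v = mvfderiv (𝓡 2) f p v • Y p + f p • nabla g Y p v := by
  conv_rhs => rw [← sum_coordComp (mem_chart_source Plane p) Y]
  simp only [nabla_apply, mvfderiv_congr (coordComp_smul_eventuallyEq p f Y _),
    (coordComp_smul_eventuallyEq p f Y _).self_of_nhds]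
  rw [Finset.smul_sum, Finset.smul_sum, ← Finset.sum_add_distrib]
  refine Finset.sum_congr rfl fun k _ ↦ ?_
  rw [mvfderiv_mul hf (mdifferentiableAt_coordComp hY k), smul_smul, smul_smul, ← add_smul]
  congr 1
  simp [Fin.sum_univ_two]
  ring

lemma gram_symm (g : Metric M) (p q : M) (i j : Fin 2) : gram g p q i j = gram g p q j i :=
  g.symm _ _ _

lemma dGram_symm (g : Metric M) (p : M) (k i j : Fin 2) : dGram g p k i j = dGram g p k j i := by
  unfold dGram
  simp only [gram_symm g p _ i j]

lemma christoffel_symm (g : Metric M) (p : M) (k i j : Fin 2) :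
    christoffel g p k i j = christoffel g p k j i := by
  simp only [christoffel, dGram_symm g p _ i j, add_comm (dGram g p i j _)]

/-- A kernel vector of the Gram matrix would be the coordinate vector of a nonzero tangent vector of
length zero. -/
lemma det_gram_ne_zero (g : Metric M) (p : M) : (Matrix.of (gram g p p)).det ≠ 0 := by
  intro h
  obtain ⟨c, hc, hc0⟩ := Matrix.exists_mulVec_eq_zero_iff.2 h
  have hv : ∑ i, c i • coordField p i p ≠ 0 := by
    intro h0
    apply hc
    ext i
    have := congrArg (coordL p i) h0
    simp only [map_sum, map_smul, coordL_coordField, map_zero] at this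
    simpa using this
  have hpos := g.pos p _ hv
  have : g.inner p (∑ i, c i • coordField p i p) (∑ i, c i • coordField p i p) =
      ∑ i, c i * (Matrix.of (gram g p p)).mulVec c i := by
    simp [Matrix.mulVec, dotProduct, gram, Fin.sum_univ_two]
    ring
  rw [this, hc0] at hpos
  simp at hpos

/-- Lowering the upper index cancels the inverse Gram matrix; what remains are the Christoffel
symbols of the first kind. -/
lemma sum_christoffel_mul_gram (g : Metric M) (p : M) (a b j : Fin 2) :
    ∑ k, christoffel g p k a b * gram g p p k j =
      (1 / 2) * (dGram g p a b j + dGram g p b a j - dGram g p j a b) := by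
  have h1 : Matrix.of (gram g p p) * (Matrix.of (gram g p p))⁻¹ = 1 :=
    Matrix.mul_nonsing_inv _ (isUnit_iff_ne_zero.2 (det_gram_ne_zero g p))
  have h2 : ∀ l, ∑ k, gram g p p k j * (Matrix.of (gram g p p))⁻¹ k l = if j = l then 1 else 0 := by
    intro l
    have := congrFun (congrFun h1 j) l
    rw [Matrix.mul_apply, Matrix.one_apply] at this
    simp only [gram_symm g p p _ j]
    exact this
  calc ∑ k, christoffel g p k a b * gram g p p k j
      = (1 / 2) * ∑ l, (∑ k, gram g p p k j * (Matrix.of (gram g p p))⁻¹ k l) *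
          (dGram g p a b l + dGram g p b a l - dGram g p l a b) := by
        simp only [christoffel, Fin.sum_univ_two]
        ring
    _ = _ := by
        simp only [h2]
        simp

lemma sum_coordL_mul_dGram (g : Metric M) (p : M) (i j : Fin 2) (v : TangentSpace (𝓡 2) p) :
    mvfderiv (𝓡 2) (fun q ↦ gram g p q i j) p v = ∑ a, coordL p a v * dGram g p a i j := by
  conv_lhs => rw [← sum_coordL p v]
  simp [dGram]

lemma diffAt_coordField (p : M) (i : Fin 2) : VField.DiffAt (coordField p i) p :=
  (contAt_coordField (mem_chart_source Plane p) i 1).mdifferentiableAt (by simp)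

/-- The connection is compatible with the metric. -/
lemma mvfderiv_inner (g : Metric M) {Y Z : VField M} {p : M} (hY : VField.DiffAt Y p)
    (hZ : VField.DiffAt Z p) (v : TangentSpace (𝓡 2) p) :
    mvfderiv (𝓡 2) (fun q ↦ g.inner q (Y q) (Z q)) p v =
      g.inner p (nabla g Y p v) (Z p) + g.inner p (Y p) (nabla g Z p v) := by
  have hdY := mdifferentiableAt_coordComp hY
  have hdZ := mdifferentiableAt_coordComp hZ
  have hdG : ∀ i j, MDifferentiableAt (𝓡 2) 𝓘(ℝ, ℝ) (fun q ↦ gram g p q i j) p := fun i j ↦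
    mdifferentiableAt_inner g (diffAt_coordField p i) (diffAt_coordField p j)
  let G (i j : Fin 2) : M → ℝ := fun q ↦ gram g p q i j
  let F (i j : Fin 2) : M → ℝ := coordComp p Y i * coordComp p Z j * G i j
  have h1 : (fun q ↦ g.inner q (Y q) (Z q)) =ᶠ[𝓝 p] (F 0 0 + F 0 1) + (F 1 0 + F 1 1) := by
    filter_upwards [eventually_mem_chart_source p] with q hq
    conv_lhs => rw [← sum_coordComp hq Y, ← sum_coordComp hq Z]
    simp [F, G, gram, Fin.sum_univ_two]
    ring
  have h2 : ∀ i j, mvfderiv (𝓡 2) (F i j) p v =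
      mvfderiv (𝓡 2) (coordComp p Y i) p v * coordComp p Z j p * gram g p p i j +
      coordComp p Y i p * mvfderiv (𝓡 2) (coordComp p Z j) p v * gram g p p i j +
      coordComp p Y i p * coordComp p Z j p * ∑ a, coordL p a v * dGram g p a i j := by
    intro i j
    rw [← sum_coordL_mul_dGram, mvfderiv_mul ((hdY i).mul (hdZ j)) (hdG i j),
      mvfderiv_mul (hdY i) (hdZ j)]
    simp
    ring
  have hd : ∀ i j, MDifferentiableAt (𝓡 2) 𝓘(ℝ, ℝ) (F i j) p := fun i j ↦
    ((hdY i).mul (hdZ j)).mul (hdG i j)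
  rw [mvfderiv_congr h1, mvfderiv_add ((hd 0 0).add (hd 0 1)) ((hd 1 0).add (hd 1 1)),
    mvfderiv_add (hd 0 0) (hd 0 1), mvfderiv_add (hd 1 0) (hd 1 1)]
  simp only [add_apply, h2]
  rw [nabla_apply, nabla_apply]
  conv_rhs => rw [← sum_coordComp (mem_chart_source Plane p) Y,
    ← sum_coordComp (mem_chart_source Plane p) Z]
  have hs : ∀ i j, g.inner p (coordField p i p) (coordField p j p) = gram g p p i j := fun _ _ ↦ rfl
  have hc := sum_christoffel_mul_gram g p
  simp only [Fin.sum_univ_two, map_add, map_smul, add_apply,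
    smul_apply, smul_eq_mul, hs, gram_symm g p p 1 0,
    dGram_symm g p _ 1 0] at hc ⊢
  have c000 := hc 0 0 0
  have c001 := hc 0 0 1
  have c010 := hc 0 1 0
  have c011 := hc 0 1 1
  have c100 := hc 1 0 0
  have c101 := hc 1 0 1
  have c110 := hc 1 1 0
  have c111 := hc 1 1 1
  simp only [gram_symm g p p 1 0, dGram_symm g p _ 1 0] at c000 c001 c010 c011 c100 c101 c110 c111
  generalize coordComp p Y 0 p = y0 at *
  generalize coordComp p Y 1 p = y1 at *
  generalize coordComp p Z 0 p = z0 at *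
  generalize coordComp p Z 1 p = z1 at *
  generalize coordL p 0 v = v0 at *
  generalize coordL p 1 v = v1 at *
  -- With Γ_{ab,j} the lowered symbol, Γ_{ai,j} + Γ_{aj,i} = ∂_a g_{ij}; each pair is weighted by
  -- the components of v, Y and Z.
  linear_combination -(v0 * y0 * z0 * 2) * c000 - v0 * (y0 * z1 + z0 * y1) * (c001 + c010)
    - (v0 * y1 * z1 * 2) * c011 - (v1 * y0 * z0 * 2) * c100
    - v1 * (y0 * z1 + z0 * y1) * (c101 + c110) - (v1 * y1 * z1 * 2) * c111

/-- The connection is torsion-free. -/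
lemma nabla_sub_nabla (g : Metric M) {X Y : VField M} {p : M} (hX : VField.DiffAt X p)
    (hY : VField.DiffAt Y p) :
    nabla g Y p (X p) - nabla g X p (Y p) = VectorField.mlieBracket (𝓡 2) X Y p := by
  have hc := diffAt_coordField p
  have hE : ∀ {Z : VField M}, Z =ᶠ[𝓝 p] coordComp p Z 0 • coordField p 0 +
      coordComp p Z 1 • coordField p 1 := fun {Z} ↦ by
    filter_upwards [eventually_mem_chart_source p] with q hq
    conv_lhs => rw [← sum_coordComp hq Z, Fin.sum_univ_two]
    rfl
  have hsm : ∀ {Z : VField M}, VField.DiffAt Z p → ∀ i,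
      VField.DiffAt (coordComp p Z i • coordField p i) p := fun hZ i ↦
    (mdifferentiableAt_coordComp hZ i).smul_section (hc i)
  -- By the Leibniz rule only derivatives of the coefficients survive, as the coordinate fields
  -- commute. The Christoffel terms cancel below by symmetry.
  have hb : ∀ i j, VectorField.mlieBracket (𝓡 2) (coordComp p X i • coordField p i)
      (coordComp p Y j • coordField p j) p =
      (coordComp p X i p * mvfderiv (𝓡 2) (coordComp p Y j) p (coordField p i p)) •
        coordField p j p -
      (coordComp p Y j p * mvfderiv (𝓡 2) (coordComp p X i) p (coordField p j p)) •
        coordField p i p := by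
    intro i j
    rw [VectorField.mlieBracket_smul_right (mdifferentiableAt_coordComp hY j) (hc j),
      VectorField.mlieBracket_smul_left (mdifferentiableAt_coordComp hX i) (hc i),
      mlieBracket_coordField]
    simp only [Pi.smul_apply', map_smul, smul_eq_mul]
    module
  rw [(hE (Z := X)).mlieBracket_vectorField_eq (hE (Z := Y)),
    VectorField.mlieBracket_add_left (hsm hX 0) (hsm hX 1),
    VectorField.mlieBracket_add_right (hsm hY 0) (hsm hY 1),
    VectorField.mlieBracket_add_right (hsm hY 0) (hsm hY 1), hb, hb, hb, hb, nabla_apply,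
    nabla_apply]
  have hv : ∀ (f : M → ℝ) (Z : VField M), mvfderiv (𝓡 2) f p (Z p) =
      coordComp p Z 0 p * mvfderiv (𝓡 2) f p (coordField p 0 p) +
      coordComp p Z 1 p * mvfderiv (𝓡 2) f p (coordField p 1 p) := by
    intro f Z
    conv_lhs => rw [← sum_coordComp (mem_chart_source Plane p) Z]
    simp [Fin.sum_univ_two]
  simp only [Fin.sum_univ_two, ← coordComp_self, hv _ X, hv _ Y, christoffel_symm g p _ 1 0]
  module

/-! ### Orthonormal frames -/

/-- The tangent vectors `u`, `v` form an orthonormal basis. -/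
structure IsOrthonormal (g : Metric M) (q : M) (u v : TangentSpace (𝓡 2) q) : Prop where
  fst : g.inner q u u = 1
  snd : g.inner q v v = 1
  orth : g.inner q u v = 0

namespace IsOrthonormal

variable {g : Metric M} {q : M} {u v : TangentSpace (𝓡 2) q}

lemma orth' (h : IsOrthonormal g q u v) : g.inner q v u = 0 := by
  rw [g.symm, h.orth]

lemma expand (h : IsOrthonormal g q u v) (w : TangentSpace (𝓡 2) q) :
    g.inner q u w • u + g.inner q v w • v = w := by
  have hli : LinearIndependent ℝ ![u, v] := by
    rw [LinearIndependent.pair_iff]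
    intro a b hab
    have h1 := congrArg (g.inner q u) hab
    have h2 := congrArg (g.inner q v) hab
    simp [h.fst, h.snd, h.orth, h.orth'] at h1 h2
    exact ⟨h1, h2⟩
  have hsp := hli.span_eq_top_of_card_eq_finrank' (by simp [finrank_tangentSpace])
  have hw : w ∈ Submodule.span ℝ (Set.range ![u, v]) := by rw [hsp]; trivial
  simp only [Matrix.range_cons, Matrix.range_empty, Set.union_empty, Set.singleton_union] at hw
  obtain ⟨a, b, rfl⟩ := Submodule.mem_span_pair.1 hw
  simp [h.fst, h.snd, h.orth, h.orth']

lemma ext_inner (h : IsOrthonormal g q u v) {w w' : TangentSpace (𝓡 2) q}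
    (h1 : g.inner q u w = g.inner q u w') (h2 : g.inner q v w = g.inner q v w') : w = w' := by
  rw [← h.expand w, ← h.expand w', h1, h2]

lemma trace_eq (h : IsOrthonormal g q u v)
    (A : TangentSpace (𝓡 2) q →L[ℝ] TangentSpace (𝓡 2) q) :
    LinearMap.trace ℝ (TangentSpace (𝓡 2) q) A.toLinearMap =
      g.inner q u (A u) + g.inner q v (A v) := by
  have hA : A.toLinearMap = (g.inner q u).toLinearMap.smulRight (A u) +
      (g.inner q v).toLinearMap.smulRight (A v) := by
    ext w
    simp only [ContinuousLinearMap.coe_coe, LinearMap.add_apply, LinearMap.smulRight_apply]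
    conv_lhs => rw [← h.expand w]
    simp
  rw [hA, map_add, LinearMap.trace_smulRight, LinearMap.trace_smulRight]
  rfl

end IsOrthonormal

/-- `T`, `N` is an orthonormal frame of class `C²` near `p`. -/
structure IsFrameAt (g : Metric M) (T N : VField M) (p : M) : Prop where
  contT : VField.ContAt 2 T p
  contN : VField.ContAt 2 N p
  eventually_orthonormal : ∀ᶠ q in 𝓝 p, IsOrthonormal g q (T q) (N q)

/-- The coefficient `g(T, ∇_N N)`. -/
def normalCurvature (g : Metric M) (T N : VField M) (q : M) : ℝ :=
  g.inner q (T q) (nabla g N q (N q))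

/-- The connection form `v ↦ g(∇_v T, N)` of an orthonormal frame. -/
def connForm (g : Metric M) (T N : VField M) (q : M) (v : TangentSpace (𝓡 2) q) : ℝ :=
  g.inner q (T q) v * geodCurvature g N q - g.inner q (N q) v * normalCurvature g T N q

namespace IsFrameAt

variable {g : Metric M} {T N : VField M} {p : M}

lemma eventually (h : IsFrameAt g T N p) : ∀ᶠ q in 𝓝 p, IsFrameAt g T N q := by
  filter_upwards [VField.ContAt.eventually (n := 2) h.contT,
    VField.ContAt.eventually (n := 2) h.contN,
    eventually_eventually_nhds.2 h.eventually_orthonormal] with q h1 h2 h3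
  exact ⟨h1, h2, h3⟩

lemma diffT (h : IsFrameAt g T N p) : VField.DiffAt T p := h.contT.mdifferentiableAt (by simp)

lemma diffN (h : IsFrameAt g T N p) : VField.DiffAt N p := h.contN.mdifferentiableAt (by simp)

lemma orthonormal (h : IsFrameAt g T N p) : IsOrthonormal g p (T p) (N p) :=
  h.eventually_orthonormal.self_of_nhds

lemma inner_nabla_T_T (h : IsFrameAt g T N p) (v : TangentSpace (𝓡 2) p) :
    g.inner p (T p) (nabla g T p v) = 0 := by
  have h1 := mvfderiv_inner g h.diffT h.diffT v
  have h2 : (fun q ↦ g.inner q (T q) (T q)) =ᶠ[𝓝 p] fun _ ↦ 1 :=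
    h.eventually_orthonormal.mono fun q hq ↦ hq.fst
  rw [mvfderiv_congr h2, mvfderiv_const, g.symm p (nabla g T p v)] at h1
  rw [zero_apply] at h1
  linarith

lemma inner_nabla_N_N (h : IsFrameAt g T N p) (v : TangentSpace (𝓡 2) p) :
    g.inner p (N p) (nabla g N p v) = 0 := by
  have h1 := mvfderiv_inner g h.diffN h.diffN v
  have h2 : (fun q ↦ g.inner q (N q) (N q)) =ᶠ[𝓝 p] fun _ ↦ 1 :=
    h.eventually_orthonormal.mono fun q hq ↦ hq.snd
  rw [mvfderiv_congr h2, mvfderiv_const, g.symm p (nabla g N p v)] at h1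
  rw [zero_apply] at h1
  linarith

lemma inner_nabla_T_N (h : IsFrameAt g T N p) (v : TangentSpace (𝓡 2) p) :
    g.inner p (N p) (nabla g T p v) = -g.inner p (T p) (nabla g N p v) := by
  have h1 := mvfderiv_inner g h.diffT h.diffN v
  have h2 : (fun q ↦ g.inner q (T q) (N q)) =ᶠ[𝓝 p] fun _ ↦ 0 :=
    h.eventually_orthonormal.mono fun q hq ↦ hq.orth
  rw [mvfderiv_congr h2, mvfderiv_const, g.symm p (nabla g T p v)] at h1
  simp at h1
  linarith

/-- The Weingarten operator kills `N`, so the trace has a single term. -/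
lemma geodCurvature_eq (h : IsFrameAt g T N p) :
    geodCurvature g N p = -g.inner p (T p) (nabla g N p (T p)) := by
  rw [geodCurvature, h.orthonormal.trace_eq]
  simp [weingarten, hat, h.orthonormal.snd, h.orthonormal.orth']

lemma nabla_N (h : IsFrameAt g T N p) (v : TangentSpace (𝓡 2) p) :
    nabla g N p v = (-connForm g T N p v) • T p := by
  have h1 : g.inner p (T p) (nabla g N p v) = -connForm g T N p v := by
    conv_lhs => rw [← h.orthonormal.expand v]
    rw [map_add, map_smul, map_smul, map_add, map_smul, map_smul, connForm, h.geodCurvature_eq,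
      normalCurvature]
    simp only [smul_eq_mul]
    ring
  rw [← h.orthonormal.expand (nabla g N p v), h.inner_nabla_N_N, h1]
  simp

lemma nabla_T (h : IsFrameAt g T N p) (v : TangentSpace (𝓡 2) p) :
    nabla g T p v = connForm g T N p v • N p := by
  rw [← h.orthonormal.expand (nabla g T p v), h.inner_nabla_T_N, h.inner_nabla_T_T, h.nabla_N]
  simp [h.orthonormal.fst]

lemma connForm_T (h : IsFrameAt g T N p) : connForm g T N p (T p) = geodCurvature g N p := by
  simp [connForm, h.orthonormal.fst, h.orthonormal.orth']

lemma connForm_N (h : IsFrameAt g T N p) :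
    connForm g T N p (N p) = -normalCurvature g T N p := by
  simp [connForm, h.orthonormal.snd, h.orthonormal.orth]

/-- Absence of torsion makes λ and κ the components of [T, N]. The bracket of C² fields is C¹, which
is how λ and κ are shown to be differentiable. -/
lemma mlieBracket_eq (h : IsFrameAt g T N p) :
    VectorField.mlieBracket (𝓡 2) T N p =
      (-geodCurvature g N p) • T p + normalCurvature g T N p • N p := by
  rw [← nabla_sub_nabla g h.diffT h.diffN, h.nabla_N, h.nabla_T, h.connForm_T, h.connForm_N]
  module

lemma contMDiffAt_geodCurvature (h : IsFrameAt g T N p) :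
    ContMDiffAt (𝓡 2) 𝓘(ℝ, ℝ) 1 (geodCurvature g N) p := by
  have h1 : ContMDiffAt (𝓡 2) 𝓘(ℝ, ℝ) 1
      (fun q ↦ -g.inner q (T q) (VectorField.mlieBracket (𝓡 2) T N q)) p :=
    (contMDiffAt_inner (by norm_num) g (h.contT.of_le (by norm_num))
      (h.contT.mlieBracket h.contN)).neg
  refine h1.congr_of_eventuallyEq (h.eventually.mono fun q hq ↦ ?_)
  simp [hq.mlieBracket_eq, hq.orthonormal.fst, hq.orthonormal.orth]

lemma contMDiffAt_normalCurvature (h : IsFrameAt g T N p) :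
    ContMDiffAt (𝓡 2) 𝓘(ℝ, ℝ) 1 (normalCurvature g T N) p := by
  have h1 : ContMDiffAt (𝓡 2) 𝓘(ℝ, ℝ) 1
      (fun q ↦ g.inner q (N q) (VectorField.mlieBracket (𝓡 2) T N q)) p :=
    contMDiffAt_inner (by norm_num) g (h.contN.of_le (by norm_num))
      (h.contT.mlieBracket h.contN)
  refine h1.congr_of_eventuallyEq (h.eventually.mono fun q hq ↦ ?_)
  simp [hq.mlieBracket_eq, hq.orthonormal.snd, hq.orthonormal.orth']

lemma mdifferentiableAt_geodCurvature (h : IsFrameAt g T N p) :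
    MDifferentiableAt (𝓡 2) 𝓘(ℝ, ℝ) (geodCurvature g N) p :=
  h.contMDiffAt_geodCurvature.mdifferentiableAt (by simp)

lemma mdifferentiableAt_normalCurvature (h : IsFrameAt g T N p) :
    MDifferentiableAt (𝓡 2) 𝓘(ℝ, ℝ) (normalCurvature g T N) p :=
  h.contMDiffAt_normalCurvature.mdifferentiableAt (by simp)

lemma nabla_smul_add_smul (h : IsFrameAt g T N p) {a b : M → ℝ}
    (ha : MDifferentiableAt (𝓡 2) 𝓘(ℝ, ℝ) a p) (hb : MDifferentiableAt (𝓡 2) 𝓘(ℝ, ℝ) b p)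
    (v : TangentSpace (𝓡 2) p) :
    nabla g (a • T + b • N) p v =
      (mvfderiv (𝓡 2) a p v - b p * connForm g T N p v) • T p +
      (mvfderiv (𝓡 2) b p v + a p * connForm g T N p v) • N p := by
  rw [nabla_add g (ha.smul_section h.diffT) (hb.smul_section h.diffN), nabla_smul g ha h.diffT,
    nabla_smul g hb h.diffN, h.nabla_T, h.nabla_N]
  module

/-- Near p the field is κT, and div(κT) = T(κ) + κ div T with div T = g(N, ∇_N T) = ω(N) = -κ. -/
lemma divergence_nabla_N (h : IsFrameAt g T N p) :
    divergence g (fun q ↦ nabla g N q (N q)) p =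
      mvfderiv (𝓡 2) (normalCurvature g T N) p (T p) - normalCurvature g T N p ^ 2 := by
  have h1 : (fun q ↦ nabla g N q (N q)) =ᶠ[𝓝 p] normalCurvature g T N • T := by
    filter_upwards [h.eventually] with q hq
    rw [hq.nabla_N, hq.connForm_N, neg_neg]
    rfl
  rw [divergence, nabla_congr g h1, h.orthonormal.trace_eq,
    nabla_smul g h.mdifferentiableAt_normalCurvature h.diffT,
    nabla_smul g h.mdifferentiableAt_normalCurvature h.diffT, h.nabla_T, h.nabla_T]
  simp [h.orthonormal.fst, h.orthonormal.snd, h.orthonormal.orth, h.orthonormal.orth',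
    h.connForm_N]
  ring

/-! ### Curvature in an orthonormal frame -/

lemma eventuallyEq_expand (h : IsFrameAt g T N p) (Y : VField M) :
    Y =ᶠ[𝓝 p] (fun q ↦ g.inner q (T q) (Y q)) • T + (fun q ↦ g.inner q (N q) (Y q)) • N :=
  h.eventually_orthonormal.mono fun q hq ↦ (hq.expand (Y q)).symm

/-- Here no chart appears on the right, so the formula can be used on a whole neighbourhood and
differentiated once more. -/
lemma nabla_eq (h : IsFrameAt g T N p) {Y : VField M} (hY : VField.DiffAt Y p)
    (v : TangentSpace (𝓡 2) p) :
    nabla g Y p v =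
      (mvfderiv (𝓡 2) (fun q ↦ g.inner q (T q) (Y q)) p v -
        g.inner p (N p) (Y p) * connForm g T N p v) • T p +
      (mvfderiv (𝓡 2) (fun q ↦ g.inner q (N q) (Y q)) p v +
        g.inner p (T p) (Y p) * connForm g T N p v) • N p := by
  rw [nabla_congr g (h.eventuallyEq_expand Y), h.nabla_smul_add_smul
    (mdifferentiableAt_inner g h.diffT hY) (mdifferentiableAt_inner g h.diffN hY)]

lemma mdifferentiableAt_connForm (h : IsFrameAt g T N p) {Y : VField M}
    (hY : VField.DiffAt Y p) :
    MDifferentiableAt (𝓡 2) 𝓘(ℝ, ℝ) (fun q ↦ connForm g T N q (Y q)) p :=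
  ((mdifferentiableAt_inner g h.diffT hY).mul h.mdifferentiableAt_geodCurvature).sub
    ((mdifferentiableAt_inner g h.diffN hY).mul h.mdifferentiableAt_normalCurvature)

lemma mvfderiv_connForm (h : IsFrameAt g T N p) {Y : VField M}
    (hY : VField.DiffAt Y p) (v : TangentSpace (𝓡 2) p) :
    mvfderiv (𝓡 2) (fun q ↦ connForm g T N q (Y q)) p v =
      mvfderiv (𝓡 2) (fun q ↦ g.inner q (T q) (Y q)) p v * geodCurvature g N p +
      g.inner p (T p) (Y p) * mvfderiv (𝓡 2) (geodCurvature g N) p v -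
      (mvfderiv (𝓡 2) (fun q ↦ g.inner q (N q) (Y q)) p v * normalCurvature g T N p +
      g.inner p (N p) (Y p) * mvfderiv (𝓡 2) (normalCurvature g T N) p v) := by
  have h1 := mdifferentiableAt_inner g h.diffT hY
  have h2 := mdifferentiableAt_inner g h.diffN hY
  have h3 := h.mdifferentiableAt_geodCurvature
  have h4 := h.mdifferentiableAt_normalCurvature
  have := mvfderiv_sub (h1.mul h3) (h2.mul h4)
  rw [mvfderiv_mul h1 h3, mvfderiv_mul h2 h4] at this
  have := congrArg (fun L ↦ L v) this
  simp only [sub_apply, add_apply, smul_apply, smul_eq_mul] at this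
  refine Eq.trans this ?_
  ring

/-- The second covariant derivative `∇_v (∇_{∂_i} ∂_k)` in terms of an orthonormal frame. -/
lemma nabla_nabla_coordField (h : IsFrameAt g T N p) (i k : Fin 2) (v : TangentSpace (𝓡 2) p) :
    let Y := coordField p k
    let X := coordField p i
    let c : M → ℝ := fun q ↦ g.inner q (T q) (Y q)
    let d : M → ℝ := fun q ↦ g.inner q (N q) (Y q)
    let w : M → ℝ := fun q ↦ connForm g T N q (X q)
    nabla g (fun q ↦ nabla g Y q (X q)) p v =
      (mvfderiv (𝓡 2) (fun q ↦ mvfderiv (𝓡 2) c q (X q)) p v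
        - mvfderiv (𝓡 2) d p v * w p - d p * mvfderiv (𝓡 2) w p v
        - (mvfderiv (𝓡 2) d p (X p) + c p * w p) * connForm g T N p v) • T p +
      (mvfderiv (𝓡 2) (fun q ↦ mvfderiv (𝓡 2) d q (X q)) p v
        + mvfderiv (𝓡 2) c p v * w p + c p * mvfderiv (𝓡 2) w p v
        + (mvfderiv (𝓡 2) c p (X p) - d p * w p) * connForm g T N p v) • N p := by
  intro Y X c d w
  have hX := diffAt_coordField p i
  have hY := diffAt_coordField p k
  have hY2 : VField.ContAt 2 Y p := contAt_coordField (mem_chart_source Plane p) k 2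
  have hc2 : ContMDiffAt (𝓡 2) 𝓘(ℝ, ℝ) 2 c p := contMDiffAt_inner le_rfl g h.contT hY2
  have hd2 : ContMDiffAt (𝓡 2) 𝓘(ℝ, ℝ) 2 d p := contMDiffAt_inner le_rfl g h.contN hY2
  have hc : MDifferentiableAt (𝓡 2) 𝓘(ℝ, ℝ) c p := hc2.mdifferentiableAt (by simp)
  have hd : MDifferentiableAt (𝓡 2) 𝓘(ℝ, ℝ) d p := hd2.mdifferentiableAt (by simp)
  have hw : MDifferentiableAt (𝓡 2) 𝓘(ℝ, ℝ) w p := h.mdifferentiableAt_connForm hX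
  have hdc := mdifferentiableAt_mvfderiv_coordField hc2 i
  have hdd := mdifferentiableAt_mvfderiv_coordField hd2 i
  set c' : M → ℝ := fun q ↦ mvfderiv (𝓡 2) c q (coordField p i q) with hc'
  set d' : M → ℝ := fun q ↦ mvfderiv (𝓡 2) d q (coordField p i q) with hd'
  have h1 : (fun q ↦ nabla g Y q (X q)) =ᶠ[𝓝 p] (c' - d * w) • T + (d' + c * w) • N := by
    filter_upwards [h.eventually, eventually_mem_chart_source p] with q hq hqp
    exact hq.nabla_eq ((contAt_coordField hqp k 1).mdifferentiableAt (by simp)) _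
  rw [nabla_congr g h1, h.nabla_smul_add_smul (hdc.sub (hd.mul hw)) (hdd.add (hc.mul hw)),
    mvfderiv_sub hdc (hd.mul hw), mvfderiv_add hdd (hc.mul hw), mvfderiv_mul hd hw,
    mvfderiv_mul hc hw]
  simp only [sub_apply, add_apply, smul_apply, smul_eq_mul, Pi.add_apply, Pi.sub_apply,
    Pi.mul_apply]
  change _ = (mvfderiv (𝓡 2) c' p v - mvfderiv (𝓡 2) d p v * w p - d p * mvfderiv (𝓡 2) w p v -
      (d' p + c p * w p) * connForm g T N p v) • T p +
    (mvfderiv (𝓡 2) d' p v + mvfderiv (𝓡 2) c p v * w p + c p * mvfderiv (𝓡 2) w p v +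
      (c' p - d p * w p) * connForm g T N p v) • N p
  congr 2 <;> ring

lemma mvfderiv_eq (h : IsFrameAt g T N p) (f : M → ℝ) (v : TangentSpace (𝓡 2) p) :
    mvfderiv (𝓡 2) f p v = g.inner p (T p) v * mvfderiv (𝓡 2) f p (T p) +
      g.inner p (N p) v * mvfderiv (𝓡 2) f p (N p) := by
  conv_lhs => rw [← h.orthonormal.expand v]
  simp

/-- Rotations of the plane commute, so the quadratic terms in ω drop out and R(X, Y) is dω(X, Y)
times the quarter turn T ↦ N, N ↦ -T. The torsion equations then evaluate dω in terms of λ and κ. -/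
theorem gaussCurvature_eq (h : IsFrameAt g T N p) :
    gaussCurvature g p = mvfderiv (𝓡 2) (normalCurvature g T N) p (T p) -
      normalCurvature g T N p ^ 2 + mvfderiv (𝓡 2) (geodCurvature g N) p (N p) -
      geodCurvature g N p ^ 2 := by
  have hX := diffAt_coordField p 0
  have hY := diffAt_coordField p 1
  have hY2 : VField.ContAt 2 (coordField p 1) p :=
    contAt_coordField (mem_chart_source Plane p) 1 2
  have hc2 := contMDiffAt_inner le_rfl g h.contT hY2
  have hd2 := contMDiffAt_inner le_rfl g h.contN hY2
  have hcc := mvfderiv_mvfderiv_coordField_comm hc2 0 1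
  have hdd := mvfderiv_mvfderiv_coordField_comm hd2 0 1
  have htor := nabla_sub_nabla g hX hY
  rw [mlieBracket_coordField, h.nabla_eq hX, h.nabla_eq hY] at htor
  -- For coordinate fields dω(X, Y) = X(ω(Y)) - Y(ω(X)). The second derivatives of the frame
  -- components of Y cancel by `hcc` and `hdd`.
  have hR : curvature g (coordField p 0) (coordField p 1) (coordField p 1) p =
      (mvfderiv (𝓡 2) (fun q ↦ connForm g T N q (coordField p 1 q)) p (coordField p 0 p) -
        mvfderiv (𝓡 2) (fun q ↦ connForm g T N q (coordField p 0 q)) p (coordField p 1 p)) •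
      ((-g.inner p (N p) (coordField p 1 p)) • T p +
        g.inner p (T p) (coordField p 1 p) • N p) := by
    rw [curvature, mlieBracket_coordField, map_zero, sub_zero, h.nabla_nabla_coordField 1 1,
      h.nabla_nabla_coordField 0 1, ← hcc, ← hdd]
    module
  have ht1 := congrArg (g.inner p (T p)) htor
  have ht2 := congrArg (g.inner p (N p)) htor
  simp only [map_sub, map_add, map_smul, map_zero, smul_eq_mul, h.orthonormal.fst,
    h.orthonormal.snd, h.orthonormal.orth, h.orthonormal.orth', mul_one, mul_zero, add_zero,
    zero_add] at ht1 ht2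
  have hgram : ∀ i j, gram g p p i j =
      g.inner p (T p) (coordField p i p) * g.inner p (T p) (coordField p j p) +
      g.inner p (N p) (coordField p i p) * g.inner p (N p) (coordField p j p) := by
    intro i j
    rw [gram]
    conv_lhs => rw [← h.orthonormal.expand (coordField p i p)]
    simp
  rw [gaussCurvature, div_eq_iff (det_gram_ne_zero g p), hR, Matrix.det_fin_two]
  simp only [Matrix.of_apply, hgram, h.mvfderiv_connForm hX, h.mvfderiv_connForm hY,
    map_add, map_smul, smul_apply, add_apply, smul_eq_mul]
  rw [h.mvfderiv_eq (geodCurvature g N) (coordField p 0 p),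
    h.mvfderiv_eq (geodCurvature g N) (coordField p 1 p),
    h.mvfderiv_eq (normalCurvature g T N) (coordField p 0 p),
    h.mvfderiv_eq (normalCurvature g T N) (coordField p 1 p)]
  unfold connForm at ht1 ht2
  generalize g.inner p (T p) (coordField p 0 p) = a at *
  generalize g.inner p (N p) (coordField p 0 p) = b at *
  generalize g.inner p (T p) (coordField p 1 p) = c at *
  generalize g.inner p (N p) (coordField p 1 p) = d at *
  -- The factor cb - da is the inner product of X with the quarter turn of Y, and its square is the
  -- Gram determinant. `ht1` and `ht2` remove the antisymmetrized derivatives of a, b, c, d.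
  linear_combination (c * b - d * a) * (geodCurvature g N p * ht1 - normalCurvature g T N p * ht2)
end IsFrameAt

/-! ### Regularity of the unit normal -/

/-- The field is the pullback of the first coordinate direction under a foliated chart. Pulling back
costs one derivative, so a C³ chart gives a C² field. -/
lemma Foliation.exists_contAt_tangent {r : WithTop ℕ∞} (hr : 3 ≤ r) (ℱ : Foliation M r) (p : M) :
    ∃ U : VField M, VField.ContAt 2 U p ∧
      ∀ᶠ q in 𝓝 p, U q ≠ 0 ∧ (⟨q, U q⟩ : TangentBundle (𝓡 2) M) ∈ ℱ.tangent := by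
  obtain ⟨φ, hφr, hp, -, hfol⟩ := ℱ.exists_chart p
  have hφ3 : φ ∈ IsManifold.maximalAtlas (𝓡 2) 3 M :=
    IsManifold.maximalAtlas_subset_of_le hr hφr
  have hφ := contMDiffOn_of_mem_maximalAtlas hφ3
  have hφs := contMDiffOn_symm_of_mem_maximalAtlas hφ3
  have hmd : φ.MDifferentiable (𝓡 2) (𝓡 2) :=
    ⟨hφ.mdifferentiableOn (by simp), hφs.mdifferentiableOn (by simp)⟩
  have hinv : ∀ q ∈ φ.source, (mfderiv (𝓡 2) (𝓡 2) φ q).IsInvertible := fun q hq ↦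
    ⟨hmd.mfderiv hq, rfl⟩
  set e : Plane := EuclideanSpace.single 0 (1 : ℝ) with he
  refine ⟨VectorField.mpullback (𝓡 2) (𝓡 2) φ (constField e), ?_, ?_⟩
  · exact (contMDiffAt_constField e (φ p) 2).mpullback_vectorField_preimage (n := 3)
      (hφ.contMDiffAt (φ.open_source.mem_nhds hp)) (hinv p hp) (by norm_num)
  filter_upwards [φ.open_source.mem_nhds hp] with q hq
  constructor
  · intro h0
    rw [VectorField.mpullback_apply, (hinv q hq).inverse_apply_eq, map_zero] at h0
    have h1 : e = 0 := h0
    have := congrFun (congrArg WithLp.ofLp h1) 0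
    simp [he] at this
  · obtain ⟨L, hL, hqL⟩ : q ∈ ⋃₀ ℱ.leaves := by rw [ℱ.iUnion_leaves]; trivial
    let c : ℝ → Plane := fun s ↦ φ q + s • e
    have hc0 : c 0 = φ q := by simp [c]
    have hcd : ContDiff ℝ 1 c := by fun_prop
    have hγ0 : φ.symm (c 0) = q := by rw [hc0, φ.left_inv hq]
    have hct : ∀ᶠ s in 𝓝 (0 : ℝ), c s ∈ φ.target :=
      hcd.continuous.continuousAt.eventually_mem
        (φ.open_target.mem_nhds (by rw [hc0]; exact φ.map_source hq))
    have hγ : ContMDiffAt 𝓘(ℝ, ℝ) (𝓡 2) 1 (φ.symm ∘ c) 0 := by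
      refine ContMDiffAt.comp 0 ?_ hcd.contMDiff.contMDiffAt
      exact ((hφs.contMDiffAt (φ.open_target.mem_nhds hct.self_of_nhds)).of_le (by norm_num))
    have key : (⟨(φ.symm ∘ c) 0, VectorField.mpullback (𝓡 2) (𝓡 2) φ (constField e)
        ((φ.symm ∘ c) 0)⟩ : TangentBundle (𝓡 2) M) ∈ ℱ.tangent := by
      refine ⟨L, hL, φ.symm ∘ c, hγ, ?_, ?_⟩
      · filter_upwards [hct] with s hs
        -- The line `c` runs inside a slice, which is a connected component of the image of the leaf
        -- through q; hence its preimage stays in that leaf.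
        have h1 : c s ∈ {y ∈ φ.target | y 1 = φ q 1} := ⟨hs, by simp [c, he]⟩
        rw [← hfol L hL q ⟨hq, hqL⟩] at h1
        obtain ⟨x, ⟨hx, hxL⟩, hxs⟩ := connectedComponentIn_subset _ _ h1
        simp only [Function.comp_apply, ← hxs, φ.left_inv hx]
        exact hxL
      · have hs : (φ.symm ∘ c) 0 ∈ φ.source := by
          rw [Function.comp_apply, hγ0]; exact hq
        have h2 : mfderiv 𝓘(ℝ, ℝ) (𝓡 2) (φ ∘ φ.symm ∘ c) 0 = mfderiv 𝓘(ℝ, ℝ) (𝓡 2) c 0 := by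
          refine Filter.EventuallyEq.mfderiv_eq ?_
          filter_upwards [hct] with s hs
          simp [φ.right_inv hs]
        have h3 : mfderiv (𝓡 2) (𝓡 2) φ ((φ.symm ∘ c) 0)
            (mfderiv 𝓘(ℝ, ℝ) (𝓡 2) (φ.symm ∘ c) 0 (1 : ℝ)) = e := by
          have h4 : HasFDerivAt c ((ContinuousLinearMap.id ℝ ℝ).smulRight e) 0 :=
            ((hasFDerivAt_id (0 : ℝ)).smul_const e).const_add _
          have h5 : fderiv ℝ c 0 (1 : ℝ) = e := by rw [h4.fderiv]; simp
          exact (mfderiv_comp_apply 0 (hmd.mdifferentiableAt hs)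
            (hγ.mdifferentiableAt (by simp)) (1 : ℝ)).symm.trans
            ((congrArg (fun L ↦ L (1 : ℝ)) (h2.trans mfderiv_eq_fderiv)).trans h5)
        have h6 : VectorField.mpullback (𝓡 2) (𝓡 2) φ (constField e) ((φ.symm ∘ c) 0) =
            mfderiv 𝓘(ℝ, ℝ) (𝓡 2) (φ.symm ∘ c) 0 (1 : ℝ) := by
          rw [VectorField.mpullback_apply]
          exact (hinv _ hs).inverse_apply_eq.2 h3.symm
        rw [h6]
    rwa [Function.comp_apply, hγ0] at key

lemma contMDiffAt_inv_sqrt {f : M → ℝ} {p : M} (hf : ContMDiffAt (𝓡 2) 𝓘(ℝ, ℝ) 2 f p)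
    (h0 : 0 < f p) : ContMDiffAt (𝓡 2) 𝓘(ℝ, ℝ) 2 (fun q ↦ (√(f q))⁻¹) p := by
  have h : ContDiffAt ℝ 2 (fun x : ℝ ↦ (√x)⁻¹) (f p) :=
    (Real.contDiffAt_sqrt h0.ne').inv (Real.sqrt_ne_zero'.2 h0)
  exact h.comp_contMDiffAt hf

/-- The vector field `W` divided by its length. -/
def normalize (g : Metric M) (W : VField M) : VField M := fun q ↦
  (√(g.inner q (W q) (W q)))⁻¹ • W q

lemma contAt_normalize (g : Metric M) {W : VField M} {p : M} (hW : VField.ContAt 2 W p)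
    (h0 : W p ≠ 0) : VField.ContAt 2 (normalize g W) p :=
  ContMDiffAt.smul_section
    (contMDiffAt_inv_sqrt (contMDiffAt_inner le_rfl g hW hW) (g.pos p _ h0)) hW

lemma inner_normalize (g : Metric M) {W : VField M} {q : M} (h0 : W q ≠ 0) :
    g.inner q (normalize g W q) (normalize g W q) = 1 := by
  have h := g.pos q _ h0
  have hs := Real.mul_self_sqrt h.le
  have hs0 := (Real.sqrt_ne_zero'.2 h)
  simp only [normalize, map_smul, smul_apply, smul_eq_mul]
  field_simp
  linarith

lemma VField.ContAt.eventually_ne_zero (g : Metric M) {W : VField M} {p : M}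
    (hW : VField.ContAt 2 W p) (h0 : W p ≠ 0) : ∀ᶠ q in 𝓝 p, W q ≠ 0 := by
  have := (contMDiffAt_inner le_rfl g hW hW).continuousAt.eventually
    (lt_mem_nhds (g.pos p _ h0))
  filter_upwards [this] with q hq h
  simp [h] at hq

section UnitNormal

variable {r : WithTop ℕ∞} {ℱ : Foliation M r} {o : TransverseOrientation ℱ}

lemma continuousAt_inner_field (g : Metric M) (o : TransverseOrientation ℱ) {W : VField M} {p : M}
    (hW : VField.ContAt 2 W p) : ContinuousAt (fun q ↦ g.inner q (W q) (o.field q)) p :=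
  (contMDiffAt_inner (n := 0) (by norm_num) g (hW.of_le (by norm_num))
    (contMDiff_zero_iff.2 o.continuous_field p)).continuousAt

/-- Near every point there is an orthonormal frame of class `C²` that consists of a tangent field
and the unit normal of the foliation. -/
lemma IsUnitNormal.exists_frame (hr : 3 ≤ r) {g : Metric M} {N : VField M}
    (hN : IsUnitNormal o g N) (p : M) : ∃ T, IsFrameAt g T N p := by
  obtain ⟨U, hU, hUt⟩ := ℱ.exists_contAt_tangent hr p
  set T := normalize g U with hTdef
  have hT : VField.ContAt 2 T p := contAt_normalize g hU hUt.self_of_nhds.1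
  have hTN : ∀ᶠ q in 𝓝 p, IsOrthonormal g q (T q) (N q) := by
    filter_upwards [hUt] with q hq
    refine ⟨inner_normalize g hq.1, hN.unit q, ?_⟩
    rw [g.symm]
    have := hN.normal _ hq.2
    simp only at this
    simp [hTdef, normalize, this]
  have hTNp := hTN.self_of_nhds
  refine ⟨T, hT, ?_, hTN⟩
  -- `N` carries no regularity assumption, so a C² candidate is built: extend `N p` with constant
  -- coefficients, remove the `T` component, normalize. It agrees with `N` near p up to sign, and
  -- the continuous transverse field fixes the sign.
  let W₀ : VField M := fun q ↦ ∑ i, coordL p i (N p) • coordField p i q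
  have hW₀p : W₀ p = N p := sum_coordL p (N p)
  have hW₀ : VField.ContAt 2 W₀ p := by
    have h1 : ∀ i, VField.ContAt 2 (fun q ↦ coordL p i (N p) • coordField p i q) p := fun i ↦
      ContMDiffAt.smul_section contMDiffAt_const
        (contAt_coordField (mem_chart_source Plane p) i 2)
    exact ContMDiffAt.sum_section fun i _ ↦ h1 i
  let W : VField M := W₀ - (fun q ↦ g.inner q (T q) (W₀ q)) • T
  have hW : VField.ContAt 2 W p := ContMDiffAt.sub_section hW₀
    (ContMDiffAt.smul_section (contMDiffAt_inner le_rfl g hT hW₀) hT)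
  have hWq : ∀ q, W q = W₀ q - g.inner q (T q) (W₀ q) • T q := fun q ↦ rfl
  have hWp : W p = N p := by
    rw [hWq, hW₀p, hTNp.orth, zero_smul, sub_zero]
  have hNp : N p ≠ 0 := by
    intro h
    have := hN.unit p
    simp [h] at this
  have hWp0 : W p ≠ 0 := hWp ▸ hNp
  set N' := normalize g W with hN'def
  have hN' : VField.ContAt 2 N' p := contAt_normalize g hW hWp0
  have hN'p : N' p = N p := by
    simp only [hN'def, normalize, hWp, hN.unit p]
    simp
  have hpos : ∀ᶠ q in 𝓝 p, 0 < g.inner q (N' q) (o.field q) := by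
    refine (continuousAt_inner_field g o hN').eventually (lt_mem_nhds ?_)
    simpa only [hN'p] using hN.positive p
  refine hN'.congr_of_eventuallyEq ?_
  filter_upwards [hpos, hTN, hW.eventually_ne_zero g hWp0] with q hq hTNq hWq0
  have hort : IsOrthonormal g q (T q) (N' q) := by
    refine ⟨hTNq.fst, inner_normalize g hWq0, ?_⟩
    have : g.inner q (T q) (W q) = 0 := by
      rw [hWq]; simp [hTNq.fst]
    simp [hN'def, normalize, this]
  have h1 := hort.expand (N q)
  rw [hTNq.orth, zero_smul, zero_add] at h1
  set a := g.inner q (N' q) (N q)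
  have h2 : a * a = 1 := by
    have := hN.unit q
    rw [← h1] at this
    simpa [hort.snd] using this
  have h3 : 0 < a * g.inner q (N' q) (o.field q) := by
    have := hN.positive q
    rw [← h1] at this
    simpa using this
  have h4 : 0 < a := pos_of_mul_pos_left h3 hq.le
  have h5 : a = 1 := by nlinarith
  rw [h5, one_smul] at h1
  rw [h1]

end UnitNormal

/-! ### The flow -/

/-- Multiplying by the integrating factor e^{-∫P} gives a function with zero right derivative. -/
lemma eq_exp_integral_mul {P f : ℝ → ℝ} {ε t : ℝ} (ht : t ∈ Ico 0 ε)
    (hP : ContinuousOn P (Ico 0 ε))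
    (hf : ∀ s ∈ Ico 0 ε, HasDerivWithinAt f (P s * f s) (Ico 0 ε) s) :
    f t = Real.exp (∫ s in (0 : ℝ)..t, P s) * f 0 := by
  have hsub : Icc 0 t ⊆ Ico 0 ε := fun s hs ↦ ⟨hs.1, hs.2.trans_lt ht.2⟩
  -- Extending `P` from [0, t] by its endpoint values makes it continuous on ℝ, so that its integral
  -- is differentiable at the endpoints too.
  set Q : ℝ → ℝ := fun s ↦ P (projIcc 0 t ht.1 s) with hQdef
  have hQ : Continuous Q :=
    (continuousOn_iff_continuous_domRestrict.1 (hP.mono hsub)).comp continuous_projIcc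
  have hQP : ∀ s ∈ Icc 0 t, Q s = P s := fun s hs ↦ by
    simp only [hQdef, projIcc_of_mem ht.1 hs]
  have hint : ∫ s in (0 : ℝ)..t, P s = ∫ s in (0 : ℝ)..t, Q s :=
    intervalIntegral.integral_congr fun s hs ↦ (hQP s (by rwa [uIcc_of_le ht.1] at hs)).symm
  set F : ℝ → ℝ := fun s ↦ Real.exp (-∫ x in (0 : ℝ)..s, Q x) * f s with hF
  have hFd : ∀ s ∈ Icc 0 t, HasDerivWithinAt F 0 (Ico 0 ε) s := by
    intro s hs
    have h1 : HasDerivAt (fun s ↦ ∫ x in (0 : ℝ)..s, Q x) (Q s) s :=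
      (hQ.integral_hasStrictDerivAt 0 s).hasDerivAt
    have h2 := (h1.fun_neg.exp.hasDerivWithinAt (s := Ico 0 ε)).mul (hf s (hsub hs))
    refine h2.congr_deriv ?_
    rw [hQP s hs]
    ring
  have hconst := constant_of_has_deriv_right_zero
    (fun s hs ↦ ((hFd s hs).continuousWithinAt.mono hsub) : ContinuousOn F (Icc 0 t))
    (fun s hs ↦ (hFd s (Ico_subset_Icc_self hs)).mono_of_mem_nhdsWithin
      (mem_of_superset (Ico_mem_nhdsGE (hs.2.trans ht.2)) (Ico_subset_Ico_left hs.1)))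
    t (right_mem_Icc.2 ht.1)
  simp only [hF, intervalIntegral.integral_same, neg_zero, Real.exp_zero, one_mul] at hconst
  rw [hint, ← hconst, ← mul_assoc, ← Real.exp_add]
  simp

section Flow

variable {r : WithTop ℕ∞} {ℱ : Foliation M r} {o : TransverseOrientation ℱ}

namespace IsUnitNormal

variable {g : Metric M} {N : VField M} {q : M} {u : TangentSpace (𝓡 2) q}

lemma orthonormal (hN : IsUnitNormal o g N) (hu : (⟨q, u⟩ : TangentBundle (𝓡 2) M) ∈ ℱ.tangent)
    (hu0 : u ≠ 0) : IsOrthonormal g q ((√(g.inner q u u))⁻¹ • u) (N q) := by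
  have h := g.pos q _ hu0
  have hs := Real.mul_self_sqrt h.le
  have hs0 := Real.sqrt_ne_zero'.2 h
  refine ⟨?_, hN.unit q, ?_⟩
  · simp only [map_smul, smul_apply, smul_eq_mul]
    field_simp
    linarith
  · have := hN.normal _ hu
    simp only at this
    rw [g.symm]
    simp [this]

lemma ext_inner (hN : IsUnitNormal o g N) (hu : (⟨q, u⟩ : TangentBundle (𝓡 2) M) ∈ ℱ.tangent)
    (hu0 : u ≠ 0) {w w' : TangentSpace (𝓡 2) q} (h1 : g.inner q u w = g.inner q u w')
    (h2 : g.inner q (N q) w = g.inner q (N q) w') : w = w' :=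
  (hN.orthonormal hu hu0).ext_inner (by simp [h1]) h2

/-- Differentiate g(N, U) = 0 along `N`, replace ∇_N U by ∇_U N + [N, U], and use g(N, ∇_U N) = 0.
The right side depends on the metric only through g(N, ·) and the bracket. -/
lemma inner_nabla_tangent (hr : 3 ≤ r) (hN : IsUnitNormal o g N) {U : VField M}
    (hU : VField.DiffAt U q)
    (hUt : ∀ᶠ x in 𝓝 q, (⟨x, U x⟩ : TangentBundle (𝓡 2) M) ∈ ℱ.tangent) :
    g.inner q (U q) (nabla g N q (N q)) =
      -g.inner q (N q) (VectorField.mlieBracket (𝓡 2) N U q) := by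
  obtain ⟨T, hT⟩ := hN.exists_frame hr q
  have h1 : (fun x ↦ g.inner x (N x) (U x)) =ᶠ[𝓝 q] fun _ ↦ 0 :=
    hUt.mono fun x hx ↦ hN.normal _ hx
  have h2 := mvfderiv_inner g hT.diffN hU (N q)
  rw [mvfderiv_congr h1, mvfderiv_const, zero_apply, g.symm q (nabla g N q (N q))] at h2
  rw [← nabla_sub_nabla g hT.diffN hU, map_sub, hT.inner_nabla_N_N]
  linarith

end IsUnitNormal

namespace IsEGF

variable {ψ : ℝ × ℝ → ℝ} {ε : ℝ} {g : ℝ → Metric M} {N : ℝ → VField M}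

lemma contDiffOn_inner (hg : IsEGF o ψ ε g N) (q : M) (u v : TangentSpace (𝓡 2) q) :
    ContDiffOn ℝ 2 (fun s ↦ (g s).inner q u v) (Ico 0 ε) := by
  have h1 : ContMDiffOn 𝓘(ℝ, ℝ) (𝓘(ℝ, ℝ).prod (𝓡 2)) 2 (fun s : ℝ ↦ (s, q)) (Ico 0 ε) :=
    contMDiffOn_id.prodMk contMDiffOn_const
  have h2 := hg.contMDiffOn.comp h1 (fun s hs ↦ ⟨hs, trivial⟩)
  have h3 := ContMDiffOn.clm_bundle_apply₂ (F₁ := Plane) (F₂ := Plane) (F₃ := ℝ)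
    (E₁ := fun p : M ↦ TangentSpace (𝓡 2) p) (E₂ := fun p : M ↦ TangentSpace (𝓡 2) p)
    (E₃ := fun _ ↦ ℝ) (b := fun _ : ℝ ↦ q) (v := fun _ ↦ u) (w := fun _ ↦ v) h2
    contMDiffOn_const contMDiffOn_const
  rw [← contMDiffOn_iff_contDiffOn]
  intro s hs
  exact (Bundle.contMDiffWithinAt_totalSpace.1 (h3 s hs)).2

/-- Truncation fixes the tangent vector u and changes v only by a multiple of the normal, which u
does not see. -/
lemma hasDerivWithinAt_inner_tangent (hg : IsEGF o ψ ε g N) {q : M} {u : TangentSpace (𝓡 2) q}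
    (hu : (⟨q, u⟩ : TangentBundle (𝓡 2) M) ∈ ℱ.tangent) (v : TangentSpace (𝓡 2) q)
    {t : ℝ} (ht : t ∈ Ico 0 ε) :
    HasDerivWithinAt (fun s ↦ (g s).inner q u v)
      (ψ (geodCurvature (g t) (N t) q, t) * (g t).inner q u v) (Ico 0 ε) t := by
  have h1 : (g t).inner q (N t q) u = 0 := (hg.isUnitNormal t ht).normal _ hu
  have h2 : (g t).inner q u (N t q) = 0 := by rw [(g t).symm, h1]
  convert hg.hasDerivWithinAt t ht q u v using 2
  simp [hat, h1, h2]

/-- The flow equation gives the speed as ∂_t g_t(U, U) / g_t(U, U), a quotient of continuous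
functions of time. -/
lemma continuousOn_speed (hr : 3 ≤ r) (hg : IsEGF o ψ ε g N) (q : M) :
    ContinuousOn (fun s ↦ ψ (geodCurvature (g s) (N s) q, s)) (Ico 0 ε) := by
  obtain ⟨U, -, hU⟩ := ℱ.exists_contAt_tangent hr q
  obtain ⟨hU0, hUt⟩ := hU.self_of_nhds
  have h1 := hg.contDiffOn_inner q (U q) (U q)
  have h2 := h1.continuousOn_derivWithin (uniqueDiffOn_Ico 0 ε) (by norm_num)
  refine (h2.div h1.continuousOn fun s _ ↦ ((g s).pos q _ hU0).ne').congr fun s hs ↦ ?_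
  have h3 := (hg.hasDerivWithinAt_inner_tangent hUt (U q) hs).derivWithin
    (uniqueDiffOn_Ico 0 ε s hs)
  rw [Pi.div_apply, h3]
  exact (mul_div_cancel_right₀ _ ((g s).pos q _ hU0).ne').symm

lemma inner_tangent_eq (hr : 3 ≤ r) (hg : IsEGF o ψ ε g N) {q : M} {u : TangentSpace (𝓡 2) q}
    (hu : (⟨q, u⟩ : TangentBundle (𝓡 2) M) ∈ ℱ.tangent) (v : TangentSpace (𝓡 2) q)
    {t : ℝ} (ht : t ∈ Ico 0 ε) :
    (g t).inner q u v = Real.exp (∫ s in (0 : ℝ)..t, ψ (geodCurvature (g s) (N s) q, s)) *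
      (g 0).inner q u v :=
  eq_exp_integral_mul ht (hg.continuousOn_speed hr q) fun _ hs ↦
    hg.hasDerivWithinAt_inner_tangent hu v hs

lemma zero_mem_Ico {t ε : ℝ} (ht : t ∈ Ico 0 ε) : (0 : ℝ) ∈ Ico 0 ε :=
  ⟨le_rfl, ht.1.trans_lt ht.2⟩

/-- The unit normal does not depend on time. -/
lemma normal_eq (hr : 3 ≤ r) (hg : IsEGF o ψ ε g N) {t : ℝ} (ht : t ∈ Ico 0 ε) :
    N t = N 0 := by
  funext q
  obtain ⟨U, -, hU⟩ := ℱ.exists_contAt_tangent hr q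
  obtain ⟨hU0, hUt⟩ := hU.self_of_nhds
  have hN0 := hg.isUnitNormal 0 (zero_mem_Ico ht)
  have h0 : (g 0).inner q (U q) (N 0 q) = 0 := by
    rw [(g 0).symm]; exact hN0.normal _ hUt
  -- Orthogonality to `U` propagates by the exponential formula, so `N 0` is a multiple of `N s` at
  -- every time.
  have horth : ∀ s ∈ Ico 0 ε, (g s).inner q (U q) (N 0 q) = 0 := fun s hs ↦ by
    rw [hg.inner_tangent_eq hr hUt (N 0 q) hs, h0, mul_zero]
  have hpar : ∀ s ∈ Ico 0 ε, (g s).inner q (N s q) (N 0 q) • N s q = N 0 q := fun s hs ↦ by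
    have := ((hg.isUnitNormal s hs).orthonormal hUt hU0).expand (N 0 q)
    simpa [horth s hs] using this
  -- As a multiple of `N s`, the vector `N 0 q` has zero truncation, so its length is constant.
  have hunit : (g t).inner q (N 0 q) (N 0 q) = 1 := by
    have h := eq_exp_integral_mul (P := fun _ ↦ 0) (f := fun s ↦ (g s).inner q (N 0 q) (N 0 q)) ht
      continuousOn_const fun s hs ↦ by
        convert hg.hasDerivWithinAt s hs q (N 0 q) (N 0 q) using 1
        have : hat (g s) (N s) q (N 0 q) = 0 := by
          simp [hat, hpar s hs]
        simp [this]
    simpa [hN0.unit q] using h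
  have hNt := hg.isUnitNormal t ht
  have h1 := hpar t ht
  have h2 : (g t).inner q (N 0 q) (o.field q) = (g 0).inner q (N 0 q) (o.field q) := by
    have := (hN0.orthonormal hUt hU0).expand (o.field q)
    conv_lhs => rw [← this]
    have h3 : (g t).inner q (N 0 q) (U q) = 0 := by rw [(g t).symm, horth t ht]
    simp [h3, hunit]
  have h3 := hN0.positive q
  rw [← h2] at h3
  have h4 := hNt.positive q
  set a := (g t).inner q (N t q) (N 0 q)
  -- `N 0 q` is a times `N t q` and both are unit vectors, so a = ±1; positivity against the
  -- transverse field selects a = 1.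
  have h5 : a * a = 1 := by
    rw [← h1] at hunit
    simpa [hNt.unit q] using hunit
  have h6 : 0 < a * (g t).inner q (N t q) (o.field q) := by
    rw [← h1] at h3
    simpa using h3
  have h7 : 0 < a := pos_of_mul_pos_left h6 h4.le
  have h8 : a = 1 := by nlinarith
  rw [h8, one_smul] at h1
  exact h1

lemma inner_normal_eq (hr : 3 ≤ r) (hg : IsEGF o ψ ε g N) {t : ℝ} (ht : t ∈ Ico 0 ε) (q : M)
    (w : TangentSpace (𝓡 2) q) : (g t).inner q (N 0 q) w = (g 0).inner q (N 0 q) w := by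
  obtain ⟨U, -, hU⟩ := ℱ.exists_contAt_tangent hr q
  obtain ⟨hU0, hUt⟩ := hU.self_of_nhds
  have hN0 := hg.isUnitNormal 0 (zero_mem_Ico ht)
  have hNt := hg.isUnitNormal t ht
  rw [hg.normal_eq hr ht] at hNt
  have h1 : (g t).inner q (N 0 q) (U q) = 0 := hNt.normal _ hUt
  have := (hN0.orthonormal hUt hU0).expand w
  conv_lhs => rw [← this]
  simp [h1, hNt.unit q]

/-- Both sides are orthogonal to `N`. Against a tangent U, the factor e^{∫ψ} in g_t(U, ·) cancels
e^{-∫ψ}, and g(U, ∇_N N) has the same value at times 0 and t. -/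
lemma nabla_normal_eq (hr : 3 ≤ r) (hg : IsEGF o ψ ε g N) {t : ℝ} (ht : t ∈ Ico 0 ε) (q : M) :
    Real.exp (-∫ s in (0 : ℝ)..t, ψ (geodCurvature (g s) (N s) q, s)) •
      nabla (g 0) (N 0) q (N 0 q) = nabla (g t) (N t) q (N t q) := by
  obtain ⟨U, hUc, hU⟩ := ℱ.exists_contAt_tangent hr q
  obtain ⟨hU0, hUt⟩ := hU.self_of_nhds
  have hUd : VField.DiffAt U q := hUc.mdifferentiableAt (by simp)
  have hUe := hU.mono fun x hx ↦ hx.2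
  have hN0 := hg.isUnitNormal 0 (zero_mem_Ico ht)
  have hNt := hg.isUnitNormal t ht
  rw [hg.normal_eq hr ht] at hNt ⊢
  obtain ⟨T₀, hT₀⟩ := hN0.exists_frame hr q
  obtain ⟨T, hT⟩ := hNt.exists_frame hr q
  refine hNt.ext_inner hUt hU0 ?_ ?_
  · rw [map_smul, hg.inner_tangent_eq hr hUt _ ht, hN0.inner_nabla_tangent hr hUd hUe,
      hNt.inner_nabla_tangent hr hUd hUe, hg.inner_normal_eq hr ht, smul_eq_mul, ← mul_assoc,
      ← Real.exp_add]
    simp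
  · rw [map_smul, hg.inner_normal_eq hr ht, hT₀.inner_nabla_N_N, hT.inner_nabla_N_N, smul_zero]

end IsEGF

end Flow

end FoliatedSurface

end

open FoliatedSurface in
theorem proposition5 {M : Type*} [TopologicalSpace M] [ChartedSpace Plane M]
    [IsManifold (𝓡 2) ∞ M] {r : WithTop ℕ∞} (hr : 3 ≤ r) (ℱ : Foliation M r)
    (o : TransverseOrientation ℱ) (ψ : ℝ × ℝ → ℝ) (hψ : ContDiff ℝ 2 ψ) (ε : ℝ)
    (g : ℝ → Metric M) (N : ℝ → VField M) (hg : IsEGF o ψ ε g N)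
    (t : ℝ) (ht : t ∈ Set.Ico 0 ε) (p : M) :
    gaussCurvature (g t) p =
      divergence (g t)
        (fun q ↦ Real.exp (-∫ s in (0 : ℝ)..t, ψ (geodCurvature (g s) (N s) q, s)) •
          nabla (g 0) (N 0) q (N 0 q)) p
      + mvfderiv (𝓡 2) (fun q ↦ geodCurvature (g t) (N t) q) p (N 0 p)
      - geodCurvature (g t) (N t) p ^ 2 := by
  obtain ⟨T, hT⟩ := (hg.isUnitNormal t ht).exists_frame hr p
  rw [hT.gaussCurvature_eq, ← hT.divergence_nabla_N, ← congrFun (hg.normal_eq hr ht) p]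
  -- The identity holds at every q, so it may be applied under the divergence.
  simp only [hg.nabla_normal_eq hr ht]
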